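/- Let $n\ge 1$ and $q\ge 2$ be integers and let $\mathbf q=\{0,1,\dots,q-1\}$. For a word $u\in\mathbf q^n$ write $S(u)=\{h : u_h\ne 0\}$. Let $\mathcal I(q,n)$ be the set of all integer tuples $(i,j,t,p)$ with $0\le p\le t\le i,j$ and $i+j\le n+t$, where in addition $p=t$ is required if $q=2$. For $(i,j,t,p)\in\mathcal I(q,n)$ let $M_{i,j}^{t,p}$ be the $\mathbf q^n\times\mathbf q^n$ matrix whose $(u,v)$ entry is $1$ if $|S(u)|=i$, $|S(v)|=j$, $|S(u)\cap S(v)|=t$ and $|\{h : v_h=u_h\neq 0\}|=p$, and is $0$ otherwise. Put $\binom{x}{y}=0$ for integers $x,y$ unless $0\le y\le x$. For integers $m,t,i,j,k$ let $$\beta_{i,j,k}^{m,t}=\binom{m-2k}{i-k}\sum_{p=0}^{m}(-1)^{k-p}\binom{k}{p}\binom{i-p}{t-p}\binom{m+p-i-k}{m+t-i-j},$$ and let $$\alpha(i,j,t,p,a,k)=\beta_{i-a,j-a,k-a}^{n-a,t-a}\,(q-1)^{\frac12(i+j)-t}\sum_{g=0}^{p}(-1)^{a-g}\binom{a}{g}\binom{t-a}{p-g}(q-2)^{t-a-p+g},$$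 where $0^0=1$ and terms with a zero coefficient are read as $0$. **Theorem.** For all complex numbers $x_{i,j}^{t,p}$, $(i,j,t,p)\in\mathcal I(q,n)$, the matrix $$M=\sum_{(i,j,t,p)\in\mathcal I(q,n)}x_{i,j}^{t,p}M_{i,j}^{t,p}$$ is (Hermitian) positive semidefinite if and only if, for all integers $a,k$ with $0\le a\le k\le n+a-k$, the matrix $$\Bigl(\sum_{t,p}\alpha(i,j,t,p,a,k)\,x_{i,j}^{t,p}\Bigr)_{i,j=k}^{n+a-k}$$ is (Hermitian) positive semidefinite, where the sum ranges over all $(t,p)$ with $(i,j,t,p)\in\mathcal I(q,n)$. Here $M$ has $q^n$ rows and columns, the number of pairs $(a,k)$ is at most $(n+1)^2$, and each of the smaller matrices has at most $n+1$ rows and columns. -/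

import Mathlib

open scoped ComplexOrder

noncomputable section

/-- Words of length `n` over the alphabet `{0, 1, …, q - 1}`. -/
abbrev Word (q n : ℕ) : Type := Fin n → Fin q

/-- The support of a word. -/
def wordSupport {q n : ℕ} (u : Word q n) : Finset (Fin n) :=
  Finset.univ.filter fun h => (u h : ℕ) ≠ 0

/-- The positions in which two words have the same nonzero letter. -/
def commonNonzero {q n : ℕ} (u v : Word q n) : Finset (Fin n) :=
  Finset.univ.filter fun h => v h = u h ∧ (u h : ℕ) ≠ 0

/-- The index set of all `(i, j, t, p)` with `0 ≤ p ≤ t ≤ i, j` and `i + j ≤ n + t`, where moreover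
`p = t` if `q = 2`. The bound `≤ n` on all four entries is implied by the other conditions. -/
def indexSet (q n : ℕ) : Finset (ℕ × ℕ × ℕ × ℕ) :=
  (Finset.range (n + 1) ×ˢ Finset.range (n + 1) ×ˢ
      Finset.range (n + 1) ×ˢ Finset.range (n + 1)).filter
    fun s => s.2.2.2 ≤ s.2.2.1 ∧ s.2.2.1 ≤ s.1 ∧ s.2.2.1 ≤ s.2.1 ∧
      s.1 + s.2.1 ≤ n + s.2.2.1 ∧ (q = 2 → s.2.2.2 = s.2.2.1)

/-- The zero-one matrix `M_{i,j}^{t,p}`. -/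
def orbitMatrix (q n i j t p : ℕ) : Matrix (Word q n) (Word q n) ℂ :=
  fun u v =>
    if (wordSupport u).card = i ∧ (wordSupport v).card = j ∧
        (wordSupport u ∩ wordSupport v).card = t ∧ (commonNonzero u v).card = p
    then 1 else 0

/-- The matrix `∑ x_{i,j}^{t,p} M_{i,j}^{t,p}`, the sum ranging over the index set. -/
def orbitCombination (q n : ℕ) (x : ℕ → ℕ → ℕ → ℕ → ℂ) : Matrix (Word q n) (Word q n) ℂ :=
  ∑ s ∈ indexSet q n,
    x s.1 s.2.1 s.2.2.1 s.2.2.2 • orbitMatrix q n s.1 s.2.1 s.2.2.1 s.2.2.2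

/-- The binomial coefficient `a` over `b` of integers, which is zero unless `0 ≤ b ≤ a`. -/
def intBinom (a b : ℤ) : ℝ :=
  if 0 ≤ b ∧ b ≤ a then (a.toNat.choose b.toNat : ℝ) else 0

/-- The number `β_{i,j,k}^{m,t}`. -/
def betaCoeff (m t i j k : ℤ) : ℝ :=
  intBinom (m - 2 * k) (i - k) *
    ∑ p ∈ Finset.Icc (0 : ℤ) m,
      (-1 : ℝ) ^ (k - p) * intBinom k p * intBinom (i - p) (t - p) *
        intBinom (m + p - i - k) (m + t - i - j)

/-- The number `α(i,j,t,p,a,k)` for words of length `n` over an alphabet of size `q`. In the last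
factor the exponent is an integer, with `0 ^ 0 = 1`; wherever that exponent is negative, its
coefficient in the product vanishes. -/
def alphaCoeff (q n i j t p a k : ℕ) : ℝ :=
  betaCoeff ((n : ℤ) - a) ((t : ℤ) - a) ((i : ℤ) - a) ((j : ℤ) - a) ((k : ℤ) - a) *
    ((q : ℝ) - 1) ^ (((i : ℝ) + (j : ℝ)) / 2 - (t : ℝ)) *
    ∑ g ∈ Finset.range (p + 1),
      (-1 : ℝ) ^ ((a : ℤ) - g) * intBinom a g * intBinom ((t : ℤ) - a) ((p : ℤ) - g) *
        ((q : ℝ) - 2) ^ ((t : ℤ) - a - p + g)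

/-- The pairs `(a, k)` with `0 ≤ a ≤ k ≤ n + a - k`. Such pairs satisfy `a ≤ n` and `k ≤ n`. -/
def blockPairs (n : ℕ) : Finset (ℕ × ℕ) :=
  (Finset.range (n + 1) ×ˢ Finset.range (n + 1)).filter
    fun s => s.1 ≤ s.2 ∧ (s.2 : ℤ) ≤ (n : ℤ) + s.1 - s.2

/-- The block `(∑_{t,p} α(i,j,t,p,a,k) x_{i,j}^{t,p})`, with rows and columns indexed by the
integers `i, j` from `k` to `n + a - k`; the sum ranges over all `(t, p)` for which `(i, j, t, p)`
belongs to the index set. -/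
def blockMatrix (q n : ℕ) (x : ℕ → ℕ → ℕ → ℕ → ℂ) (a k : ℕ) :
    Matrix (Finset.Icc k (n + a - k)) (Finset.Icc k (n + a - k)) ℂ :=
  fun i j =>
    ∑ s ∈ (Finset.range (n + 1) ×ˢ Finset.range (n + 1)).filter
        (fun s => ((i : ℕ), (j : ℕ), s.1, s.2) ∈ indexSet q n),
      (alphaCoeff q n i j s.1 s.2 a k : ℂ) * x i j s.1 s.2

end

/-!
The matrix `∑ x_{i,j}^{t,p} M_{i,j}^{t,p}` is block diagonalized in two steps.

*From words to subsets.* The space of functions on words is the `n`-th tensor power of `ℂ^q`. The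
entry at `(u, v)` is the value of a linear functional on polynomials at a product over the positions
of monomials depending only on the two letters (`orbitCombination_apply`), so a change of basis on
`ℂ^q` can be carried out one position at a time. An orthonormal basis of `ℂ^q` consisting of the
letter `0`, the uniform vector on the nonzero letters, and vectors on the nonzero letters with sum
zero is used. In the new basis (`posSemidef_adaptedMatrix_iff`) the matrix is block diagonal with
respect to the positions and the indices of the basis vectors of the third kind; a block with `a`
such positions has rows and columns indexed by the subsets of the other `n - a` positions, and its
entry at `(U, V)` depends only on `|U|`, `|V|`, `|U ∩ V|`. If `q = 2` there are no vectors of the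
third kind, but the matrices for `a > 0` are then principal submatrices of the one for `a = 0`.

*Subsets.* It remains to block diagonalize a matrix `(y |U| |V| |U ∩ V|)` indexed by the subsets of
an `m`-set (`posSemidef_subsetMatrix_iff`). Every function on subsets is, level by level, a sum of
functions `U ↦ ∑_{K ⊆ U} b K` with `b` supported on `k`-sets and killed by the lowering operator
(`exists_isNull_decomposition_of_range`). For such `b` the sums over the sets `K` with `|K ∩ U| = s`
are all proportional to the one for `s = k` (`IsNull.sum_card_inter`), so the matrix preserves this
decomposition, and counting shows that its action is given by the numbers `β`
(`IsNull.sum_sum_star_subsetSum_mul`).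

The two steps combine since the inner sums in `α` are the coefficients of
`(X - 1)^a (X + q - 2)^(t - a)` (`coeff_blockPolynomial`).
-/

/-! ### Null functions on the lattice of subsets -/

section Subsets

variable {α : Type*} [Fintype α] [DecidableEq α]

/-- The function `U ↦ ∑_{K ⊆ U} b K`. For `b` supported on `k`-sets, its restriction to the `i`-sets
is, up to the factor `(i - k)!`, the result of applying the raising operator `i - k` times. -/
def subsetSum (b : Finset α → ℂ) (U : Finset α) : ℂ := ∑ K ∈ U.powerset, b K

/-- A function on subsets that is supported on the `k`-sets and is killed by the lowering operator
`b ↦ (J ↦ ∑_{x ∉ J} b (J ∪ {x}))`. -/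
structure IsNull (k : ℕ) (b : Finset α → ℂ) : Prop where
  card_eq : ∀ K, b K ≠ 0 → K.card = k
  sum_insert : ∀ J, ∑ x ∈ Jᶜ, b (insert x J) = 0

/-- Reindexing of the pairs `(J, x)` with `x ∉ J` as the pairs `(K, x)` with `x ∈ K`, by
`K = J ∪ {x}`: the lowering and raising operators are adjoint to each other. -/
theorem sum_insert_compl_eq (F : Finset α → Finset α → ℂ) :
    ∑ J : Finset α, ∑ x ∈ Jᶜ, F J (insert x J) = ∑ K : Finset α, ∑ x ∈ K, F (K.erase x) K := by
  rw [Finset.sum_sigma', Finset.sum_sigma']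
  refine Finset.sum_bij' (fun p _ => ⟨insert p.2 p.1, p.2⟩) (fun p _ => ⟨p.1.erase p.2, p.2⟩)
    ?_ ?_ ?_ ?_ ?_ <;> rintro ⟨J, x⟩ h <;> simp at h ⊢ <;> simp [h]

theorem card_erase_inter {β : Type*} [DecidableEq β] (K U : Finset β) (x : β) :
    (K.erase x ∩ U).card = if x ∈ K ∩ U then (K ∩ U).card - 1 else (K ∩ U).card := by
  rw [Finset.erase_inter]
  split_ifs with h
  · exact Finset.card_erase_of_mem h
  · rw [Finset.erase_eq_of_notMem h]

/-- Removing one element from `K` leaves `s` elements in `U` in two ways: an element outside `U` is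
removed from a `K` meeting `U` in `s` elements, or an element of `U` from a `K` meeting `U` in
`s + 1` elements. -/
theorem card_filter_card_erase_inter {β : Type*} [DecidableEq β] (K U : Finset β) (s : ℕ) :
    (K.filter fun x => (K.erase x ∩ U).card = s).card =
      (if (K ∩ U).card = s then K.card - s else 0) +
        if (K ∩ U).card = s + 1 then s + 1 else 0 := by
  have h1 : (K ∩ U).card + (K \ U).card = K.card := Finset.card_inter_add_card_sdiff K U
  rcases eq_or_ne (K ∩ U).card s with h | h
  · have : (K.filter fun x => (K.erase x ∩ U).card = s) = K \ U := by
      ext x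
      simp only [Finset.mem_filter, card_erase_inter, Finset.mem_sdiff]
      by_cases hx : x ∈ K <;> by_cases hu : x ∈ U <;> simp [hx, hu, h]
      have : 0 < (K ∩ U).card := Finset.card_pos.2 ⟨x, by simp [hx, hu]⟩
      omega
    rw [this]
    simp [h]
    omega
  · rcases eq_or_ne (K ∩ U).card (s + 1) with h' | h'
    · have : (K.filter fun x => (K.erase x ∩ U).card = s) = K ∩ U := by
        ext x
        simp only [Finset.mem_filter, card_erase_inter, Finset.mem_inter]
        by_cases hx : x ∈ K <;> by_cases hu : x ∈ U <;> simp [hx, hu, h']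
      rw [this]
      simp [h']
    · rw [if_neg h, if_neg h', Finset.card_eq_zero, Finset.filter_eq_empty_iff]
      intro x hx
      rw [card_erase_inter]
      split_ifs with hxu
      · have : 0 < (K ∩ U).card := Finset.card_pos.2 ⟨x, hxu⟩
        omega
      · exact h

/-- The two-term recursion in `s`, obtained by summing the null condition over all `J` that meet `U`
in `s` elements. -/
theorem IsNull.sum_card_inter_step {k : ℕ} {b : Finset α → ℂ} (hb : IsNull k b) (U : Finset α)
    {s : ℕ} (hs : s < k) :
    ((k : ℂ) - s) * ∑ K with (K ∩ U).card = s, b K +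
      ((s : ℂ) + 1) * ∑ K with (K ∩ U).card = s + 1, b K = 0 := by
  have h := sum_insert_compl_eq (fun J K : Finset α => if (J ∩ U).card = s then b K else 0)
  have h0 : ∑ J : Finset α, ∑ x ∈ Jᶜ,
      (if (J ∩ U).card = s then b (insert x J) else 0) = 0 := by
    refine Finset.sum_eq_zero fun J _ => ?_
    split_ifs
    · exact hb.sum_insert J
    · simp
  rw [h0] at h
  rw [h, Finset.mul_sum, Finset.mul_sum, Finset.sum_filter, Finset.sum_filter,
    ← Finset.sum_add_distrib]
  refine Finset.sum_congr rfl fun K _ => ?_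
  rw [← Finset.sum_filter, Finset.sum_const, card_filter_card_erase_inter, nsmul_eq_mul]
  by_cases hK : b K = 0
  · simp [hK]
  · have := hb.card_eq K hK
    rw [this]
    split_ifs <;> first | omega | (push_cast [Nat.cast_sub hs.le]; ring)

theorem IsNull.subsetSum_eq {k : ℕ} {b : Finset α → ℂ} (hb : IsNull k b) (U : Finset α) :
    subsetSum b U = ∑ K with (K ∩ U).card = k, b K := by
  rw [subsetSum, ← Finset.sum_filter_ne_zero]
  conv_rhs => rw [← Finset.sum_filter_ne_zero]
  refine Finset.sum_congr ?_ fun _ _ => rfl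
  ext K
  simp only [Finset.mem_filter, Finset.mem_powerset, Finset.mem_univ, true_and]
  refine and_congr_left fun h => ?_
  rw [← hb.card_eq K h]
  constructor
  · intro h; rw [Finset.inter_eq_left.2 h]
  · intro h
    exact Finset.inter_eq_left.1
      (Finset.eq_of_subset_of_card_le Finset.inter_subset_left h.ge)

/-- The sums of a null function over the sets meeting `U` in a given number of elements are all
multiples of `subsetSum b U`. -/
theorem IsNull.sum_card_inter {k : ℕ} {b : Finset α → ℂ} (hb : IsNull k b) (U : Finset α)
    {s : ℕ} (hs : s ≤ k) :
    ∑ K with (K ∩ U).card = s, b K = (-1) ^ (k - s) * (k.choose s : ℂ) * subsetSum b U := by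
  induction hs using Nat.decreasingInduction with
  | self => simp [hb.subsetSum_eq]
  | of_succ s hs ih =>
    have h := hb.sum_card_inter_step U hs
    rw [ih] at h
    have hne : (k : ℂ) - s ≠ 0 := sub_ne_zero.2 (by exact_mod_cast hs.ne')
    apply mul_left_cancel₀ hne
    have hc : (k.choose (s + 1) : ℂ) * (s + 1) = k.choose s * (k - s) := by
      have := Nat.choose_succ_right_eq k s
      rw [← Nat.cast_sub hs.le]
      exact_mod_cast this
    have hp : (-1 : ℂ) ^ (k - s) = - (-1) ^ (k - (s + 1)) := by
      rw [show k - s = (k - (s + 1)) + 1 by omega, pow_succ]; ring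
    rw [hp]
    linear_combination h - (-1) ^ (k - (s + 1)) * subsetSum b U * hc

theorem IsNull.subsetSum_eq_zero_of_lt {k : ℕ} {b : Finset α → ℂ} (hb : IsNull k b)
    {U : Finset α} (h : U.card < k) : subsetSum b U = 0 := by
  refine Finset.sum_eq_zero fun K hK => ?_
  by_contra hne
  have := Finset.card_le_card (Finset.mem_powerset.1 hK)
  have := hb.card_eq K hne
  omega

/-- Above level `m - k` every `k`-set meets `U`, so the sum over the `k`-sets disjoint from `U` is
empty, while it equals `± subsetSum b U`. -/
theorem IsNull.subsetSum_eq_zero_of_gt {k : ℕ} {b : Finset α → ℂ} (hb : IsNull k b)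
    {U : Finset α} (h : Fintype.card α < U.card + k) : subsetSum b U = 0 := by
  have h0 : ∑ K with (K ∩ U).card = 0, b K = 0 := by
    refine Finset.sum_eq_zero fun K hK => ?_
    by_contra hne
    have h1 := hb.card_eq K hne
    have h2 : (K ∩ U).card = 0 := by simpa using hK
    have h3 := Finset.card_union_add_card_inter K U
    have h4 := Finset.card_le_univ (K ∪ U)
    omega
  rw [hb.sum_card_inter U (Nat.zero_le k)] at h0
  simpa using h0

/-- The sets `V ⊇ K` with prescribed numbers of further elements inside and outside `U`: these
elements are chosen from `U \ K` and from the complement of `U ∪ K` independently. -/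
theorem card_filter_superset (U K : Finset α) (t r : ℕ) :
    ((Finset.univ : Finset (Finset α)).filter
      fun V => K ⊆ V ∧ (V ∩ U).card = (K ∩ U).card + t ∧ (V \ U).card = (K \ U).card + r).card =
      (U \ K).card.choose t * ((U ∪ K)ᶜ).card.choose r := by
  rw [← Finset.card_powersetCard, ← Finset.card_powersetCard, ← Finset.card_product]
  refine Finset.card_nbij' (fun V => ((V ∩ U) \ K, (V \ U) \ K)) (fun p => p.1 ∪ p.2 ∪ K)
    ?_ ?_ ?_ ?_
  · intro V hV
    simp only [Finset.coe_filter, Finset.mem_univ, true_and, Set.mem_ofPred_eq] at hV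
    obtain ⟨h1, h2, h3⟩ := hV
    have e1 : (V ∩ U) \ K = (V ∩ U) \ (K ∩ U) := by grind [Finset.mem_compl]
    have e2 : (V \ U) \ K = (V \ U) \ (K \ U) := by grind [Finset.mem_compl]
    simp only [Finset.coe_product, Set.mem_prod, Finset.mem_coe, Finset.mem_powersetCard]
    refine ⟨⟨by grind [Finset.mem_compl], ?_⟩, by grind [Finset.mem_compl], ?_⟩
    · rw [e1, Finset.card_sdiff_of_subset (by grind [Finset.mem_compl])]; omega
    · rw [e2, Finset.card_sdiff_of_subset (by grind [Finset.mem_compl])]; omega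
  · rintro ⟨X, Y⟩ h
    simp only [Finset.coe_product, Set.mem_prod, Finset.mem_coe, Finset.mem_powersetCard] at h
    obtain ⟨⟨h1, h2⟩, h3, h4⟩ := h
    have h5 : Y ∩ U = ∅ := by grind [Finset.mem_compl]
    have h6 : Y ∩ K = ∅ := by grind [Finset.mem_compl]
    simp only [Finset.coe_filter, Finset.mem_univ, true_and, Set.mem_ofPred_eq]
    refine ⟨by grind [Finset.mem_compl], ?_, ?_⟩
    · rw [show (X ∪ Y ∪ K) ∩ U = (K ∩ U) ∪ X by grind [Finset.mem_compl],
        Finset.card_union_of_disjoint, h2]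
      rw [Finset.disjoint_left]; grind [Finset.mem_compl]
    · rw [show (X ∪ Y ∪ K) \ U = (K \ U) ∪ Y by grind [Finset.mem_compl],
        Finset.card_union_of_disjoint, h4]
      rw [Finset.disjoint_left]; grind [Finset.mem_compl]
  · intro V hV
    simp only [Finset.coe_filter, Finset.mem_univ, true_and, Set.mem_ofPred_eq] at hV
    obtain ⟨h1, -⟩ := hV
    grind [Finset.mem_compl]
  · rintro ⟨X, Y⟩ h
    simp only [Finset.coe_product, Set.mem_prod, Finset.mem_coe, Finset.mem_powersetCard] at h
    obtain ⟨⟨h1, h2⟩, h3, h4⟩ := h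
    simp only [Prod.mk.injEq]
    constructor <;> ext x <;> grind [Finset.mem_compl]

end Subsets

/-! ### The coefficients `β` -/

theorem intBinom_natCast (a b : ℕ) : intBinom a b = a.choose b := by
  unfold intBinom
  split_ifs with h
  · simp
  · rw [Nat.choose_eq_zero_of_lt (by omega)]; simp

theorem intBinom_eq_zero_of_neg (a : ℤ) {b : ℤ} (h : b < 0) : intBinom a b = 0 :=
  if_neg (by omega)

theorem intBinom_eq_zero_of_lt {a b : ℤ} (h : a < b) : intBinom a b = 0 :=
  if_neg (by omega)

theorem intBinom_symm (a b : ℤ) : intBinom a (a - b) = intBinom a b := by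
  unfold intBinom
  split_ifs with h1 h2 h2
  · rw [← Nat.choose_symm (n := a.toNat) (k := b.toNat) (by omega)]
    congr 2; omega
  · omega
  · omega
  · rfl

/-- At natural arguments the summation in `β` runs effectively over `0 ≤ s ≤ k`; if `m < k` the
first factor vanishes. -/
theorem betaCoeff_natCast (m t i j k : ℕ) :
    betaCoeff m t i j k = intBinom ((m : ℤ) - 2 * k) ((i : ℤ) - k) *
      ∑ s ∈ Finset.range (k + 1), (-1 : ℝ) ^ (k - s) * k.choose s *
        (intBinom ((i : ℤ) - s) ((t : ℤ) - s) *
          intBinom ((m : ℤ) + s - i - k) ((m : ℤ) + t - i - j)) := by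
  unfold betaCoeff
  rcases lt_or_ge m k with hk | hk
  · rcases lt_or_ge i k with hi | hi
    · rw [intBinom_eq_zero_of_neg _ (by omega)]; simp
    · rw [intBinom_eq_zero_of_lt (by omega)]; simp
  congr 1
  have hI : Finset.Icc (0 : ℤ) m = (Finset.range (m + 1)).map Nat.castEmbedding := by
    ext x
    simp only [Finset.mem_Icc, Finset.mem_map, Finset.mem_range, Nat.castEmbedding_apply]
    constructor
    · rintro ⟨h1, h2⟩; exact ⟨x.toNat, by omega, by omega⟩
    · rintro ⟨y, h1, rfl⟩; omega
  rw [hI, Finset.sum_map]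
  symm
  refine Finset.sum_subset_zero_on_sdiff (by intro x; simp; omega) ?_ ?_
  · intro x hx
    simp only [Finset.mem_sdiff, Finset.mem_range] at hx
    rw [Nat.castEmbedding_apply, intBinom_natCast, Nat.choose_eq_zero_of_lt (by omega)]
    simp
  · intro s hs
    have hs' : s ≤ k := by simpa [Nat.lt_succ_iff] using hs
    rw [Nat.castEmbedding_apply, intBinom_natCast, ← Nat.cast_sub hs', zpow_natCast]
    ring

/-- The left-hand side is a `k`-th finite difference of a binomial coefficient. It is the eigenvalue
that governs `∑_{|U| = i} |subsetSum b U|²` for a null function `b`. -/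
theorem sum_alternating_intBinom {m i k : ℕ} (hk : k ≤ i) (hi : i + k ≤ m) :
    ∑ s ∈ Finset.range (k + 1), (-1 : ℝ) ^ (k - s) * k.choose s *
      (intBinom ((k : ℤ) - s) ((k : ℤ) - s) * intBinom ((m : ℤ) + s - k - k) ((m : ℤ) + k - k - i))
    = intBinom ((m : ℤ) - 2 * k) ((i : ℤ) - k) := by
  have h := fwdDiff_iter_eq_sum_shift (1 : ℕ) (fun x ↦ x.choose (k + (m - i - k)) : ℕ → ℤ) k
    (m - 2 * k)
  rw [fwdDiff_iter_choose] at h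
  have h' := congrArg (Int.cast : ℤ → ℝ) h
  push_cast at h'
  rw [show (m : ℤ) - 2 * k = ((m - 2 * k : ℕ) : ℤ) by omega,
    ← intBinom_symm, show ((m - 2 * k : ℕ) : ℤ) - ((i : ℤ) - k) = ((m - i - k : ℕ) : ℤ) by omega,
    intBinom_natCast, h']
  refine Finset.sum_congr rfl fun s hs => ?_
  have hs' : s ≤ k := by simpa [Nat.lt_succ_iff] using hs
  rw [show (k : ℤ) - s = ((k - s : ℕ) : ℤ) by omega, intBinom_natCast, Nat.choose_self,
    show (m : ℤ) + s - k - k = ((m - 2 * k + s : ℕ) : ℤ) by omega,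
    show (m : ℤ) + k - k - i = ((k + (m - i - k) : ℕ) : ℤ) by omega, intBinom_natCast]
  simp

/-! ### The action of intersection matrices on null functions -/

section Subsets

variable {α : Type*} [Fintype α] [DecidableEq α]

/-- The number of `j`-sets `V ⊇ K` meeting `U` in `t` elements, with the conventions of `intBinom`
taking care of the cases in which there is none. -/
theorem card_filter_superset_card_inter (U K : Finset α) (j t : ℕ) :
    (((Finset.univ : Finset (Finset α)).filter
      fun V => K ⊆ V ∧ V.card = j ∧ (V ∩ U).card = t).card : ℝ) =
      intBinom ((U.card : ℤ) - (K ∩ U).card) ((t : ℤ) - (K ∩ U).card) *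
        intBinom ((Fintype.card α : ℤ) + (K ∩ U).card - U.card - K.card)
          ((Fintype.card α : ℤ) + t - U.card - j) := by
  set m := Fintype.card α
  set s := (K ∩ U).card with hs
  have hK : s + (K \ U).card = K.card := Finset.card_inter_add_card_sdiff K U
  have hUK : (U \ K).card + s = U.card := by
    rw [hs, Finset.inter_comm]; exact Finset.card_sdiff_add_card_inter U K
  have hC : ((U ∪ K)ᶜ).card + (U ∪ K).card = m := Finset.card_compl_add_card _
  have hun : (U ∪ K).card + s = U.card + K.card := by
    rw [hs, Finset.inter_comm]; exact Finset.card_union_add_card_inter U K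
  by_cases h : s ≤ t ∧ t ≤ j ∧ K.card - s ≤ j - t
  · obtain ⟨h1, h2, h3⟩ := h
    have hf : ((Finset.univ : Finset (Finset α)).filter
        fun V => K ⊆ V ∧ V.card = j ∧ (V ∩ U).card = t) = Finset.univ.filter fun V =>
          K ⊆ V ∧ (V ∩ U).card = s + (t - s) ∧
            (V \ U).card = (K \ U).card + ((j - t) - (K \ U).card) := by
      ext V
      have := Finset.card_inter_add_card_sdiff V U
      simp only [Finset.mem_filter, Finset.mem_univ, true_and]
      refine and_congr_right fun _ => ?_
      omega
    rw [hf, hs, card_filter_superset, ← hs, Nat.cast_mul]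
    congr 1
    · rw [← intBinom_natCast]; congr 1 <;> omega
    · rw [← intBinom_natCast, ← intBinom_symm]; congr 1 <;> omega
  · have hf : ((Finset.univ : Finset (Finset α)).filter
        fun V => K ⊆ V ∧ V.card = j ∧ (V ∩ U).card = t) = ∅ := by
      rw [Finset.filter_eq_empty_iff]
      rintro V - ⟨h1, h2, h3⟩
      have h4 := Finset.card_inter_add_card_sdiff V U
      have h5 : s ≤ (V ∩ U).card := Finset.card_le_card (Finset.inter_subset_inter_right h1)
      have h6 : (K \ U).card ≤ (V \ U).card :=
        Finset.card_le_card (Finset.sdiff_subset_sdiff h1 le_rfl)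
      omega
    rw [hf, Finset.card_empty, Nat.cast_zero]
    rcases lt_or_ge t s with h1 | h1
    · rw [intBinom_eq_zero_of_neg _ (by omega), zero_mul]
    · rw [intBinom_eq_zero_of_lt (b := (m : ℤ) + t - U.card - j) (by omega), mul_zero]

theorem IsNull.sum_mul_card_inter {k : ℕ} {b : Finset α → ℂ} (hb : IsNull k b) (U : Finset α)
    (w : ℕ → ℂ) :
    ∑ K, b K * w (K ∩ U).card =
      (∑ s ∈ Finset.range (k + 1), (-1) ^ (k - s) * (k.choose s : ℂ) * w s) * subsetSum b U := by
  have h : ∀ K, b K * w (K ∩ U).card =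
      ∑ s ∈ Finset.range (k + 1), if (K ∩ U).card = s then b K * w s else 0 := by
    intro K
    rw [Finset.sum_ite_eq]
    split_ifs with h
    · rfl
    · have : b K = 0 := by
        by_contra hne
        have h1 := hb.card_eq K hne
        have h2 : (K ∩ U).card ≤ K.card := Finset.card_le_card Finset.inter_subset_left
        simp at h
        omega
      simp [this]
  rw [Finset.sum_congr rfl fun K _ => h K, Finset.sum_comm, Finset.sum_mul]
  refine Finset.sum_congr rfl fun s hs => ?_
  rw [← Finset.sum_filter, ← Finset.sum_mul,
    hb.sum_card_inter U (by simpa [Nat.lt_succ_iff] using hs)]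
  ring

/-- A matrix with rows `U` and columns the `j`-sets `V`, whose entries depend only on `|U|` and
`|U ∩ V|`, maps `subsetSum b` to a multiple of `subsetSum b` if `b` is null; the scalar is, up to
the factor `C(m - 2k, i - k)`, a combination of the numbers `β`. -/
theorem IsNull.sum_weight_mul_subsetSum {k : ℕ} {b : Finset α → ℂ} (hb : IsNull k b)
    (U : Finset α) (j : ℕ) (y : ℕ → ℂ) :
    ∑ V with V.card = j, y (V ∩ U).card * subsetSum b V =
      (∑ t ∈ Finset.range (Fintype.card α + 1), y t *
        ((∑ s ∈ Finset.range (k + 1), (-1 : ℝ) ^ (k - s) * k.choose s *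
          (intBinom ((U.card : ℤ) - s) ((t : ℤ) - s) *
            intBinom ((Fintype.card α : ℤ) + s - U.card - k)
              ((Fintype.card α : ℤ) + t - U.card - j)) : ℝ) : ℂ)) * subsetSum b U := by
  have h1 : ∑ V with V.card = j, y (V ∩ U).card * subsetSum b V =
      ∑ K, b K * ∑ t ∈ Finset.range (Fintype.card α + 1), y t *
        (((intBinom ((U.card : ℤ) - (K ∩ U).card) ((t : ℤ) - (K ∩ U).card) *
            intBinom ((Fintype.card α : ℤ) + (K ∩ U).card - U.card - k)
              ((Fintype.card α : ℤ) + t - U.card - j)) : ℝ) : ℂ) := by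
    simp only [subsetSum, Finset.mul_sum]
    rw [Finset.sum_comm' (t' := Finset.univ)
      (s' := fun K => Finset.univ.filter fun V => K ⊆ V ∧ V.card = j)
      (by intro V K; simp [and_comm])]
    refine Finset.sum_congr rfl fun K _ => ?_
    rw [← Finset.sum_mul, mul_comm, ← Finset.mul_sum]
    by_cases hK : b K = 0
    · simp [hK]
    congr 1
    rw [← Finset.sum_fiberwise_of_maps_to (g := fun V => (V ∩ U).card)
      (t := Finset.range (Fintype.card α + 1))
      (fun V _ => by simpa [Nat.lt_succ_iff] using Finset.card_le_univ _)]
    refine Finset.sum_congr rfl fun t _ => ?_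
    rw [← hb.card_eq K hK, ← card_filter_superset_card_inter, Finset.filter_filter]
    rw [Finset.sum_congr rfl (g := fun _ => y t)
      (by intro V hV; simp only [Finset.mem_filter] at hV; rw [hV.2.2])]
    simp only [Finset.sum_const, nsmul_eq_mul, and_assoc]
    push_cast
    ring
  rw [h1, hb.sum_mul_card_inter U (fun s => ∑ t ∈ Finset.range (Fintype.card α + 1), y t *
        (((intBinom ((U.card : ℤ) - s) ((t : ℤ) - s) *
            intBinom ((Fintype.card α : ℤ) + s - U.card - k)
              ((Fintype.card α : ℤ) + t - U.card - j)) : ℝ) : ℂ))]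
  congr 1
  simp only [Finset.mul_sum]
  rw [Finset.sum_comm]
  refine Finset.sum_congr rfl fun t _ => ?_
  push_cast
  rw [Finset.mul_sum]
  refine Finset.sum_congr rfl fun s _ => ?_
  ring

theorem IsNull.subsetSum_of_card_eq {k : ℕ} {b : Finset α → ℂ} (hb : IsNull k b) {K : Finset α}
    (hK : K.card = k) : subsetSum b K = b K := by
  refine Finset.sum_eq_single_of_mem K (Finset.mem_powerset_self K) fun L hL hne => ?_
  by_contra h
  exact hne (Finset.eq_of_subset_of_card_le (Finset.mem_powerset.1 hL)
    (by rw [hK, hb.card_eq L h]))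

theorem IsNull.sum_star_mul_subsetSum_eq_zero {k k' : ℕ} {b b' : Finset α → ℂ} (hb : IsNull k b)
    (hb' : IsNull k' b') (hk : k ≠ k') : ∑ K, star (b K) * subsetSum b' K = 0 := by
  rcases lt_or_gt_of_ne hk with h | h
  · refine Finset.sum_eq_zero fun K _ => ?_
    by_cases hK : b K = 0
    · simp [hK]
    · rw [hb'.subsetSum_eq_zero_of_lt (by rw [hb.card_eq K hK]; exact h), mul_zero]
  · simp only [subsetSum, Finset.mul_sum]
    rw [Finset.sum_comm' (t' := Finset.univ) (s' := fun L => Finset.univ.filter fun K => L ⊆ K)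
      (by intro V K; simp)]
    refine Finset.sum_eq_zero fun L _ => ?_
    by_cases hL : b' L = 0
    · simp [hL]
    rw [← Finset.sum_mul, ← star_sum]
    have h1 : (Finset.univ.filter fun K => L ⊆ K) =
        Finset.univ.filter fun K : Finset α => (K ∩ L).card = k' := by
      ext K
      simp only [Finset.mem_filter, Finset.mem_univ, true_and, ← hb'.card_eq L hL]
      constructor
      · intro h; rw [Finset.inter_eq_right.2 h]
      · intro h; exact Finset.inter_eq_right.1
          (Finset.eq_of_subset_of_card_le Finset.inter_subset_right h.ge)
    rw [h1, hb.sum_card_inter L h.le,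
      hb.subsetSum_eq_zero_of_lt (by rw [hb'.card_eq L hL]; exact h)]
    simp

/-- On each level, null functions of different degrees give orthogonal vectors, and for equal
degrees the inner product is that of the null functions times `C(m - 2k, i - k)`. -/
theorem IsNull.sum_star_subsetSum_mul_subsetSum {k k' : ℕ} {b b' : Finset α → ℂ}
    (hb : IsNull k b) (hb' : IsNull k' b') (i : ℕ) :
    ∑ U with U.card = i, star (subsetSum b U) * subsetSum b' U =
      if k = k' then (intBinom ((Fintype.card α : ℤ) - 2 * k) ((i : ℤ) - k) : ℂ) *
        ∑ K, star (b K) * b' K else 0 := by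
  -- Outside the levels `k ≤ i ≤ m - k` both sides vanish.
  by_cases hi : k ≤ i ∧ i + k ≤ Fintype.card α
  swap
  · have h0 : ∑ U with U.card = i, star (subsetSum b U) * subsetSum b' U = 0 := by
      refine Finset.sum_eq_zero fun U hU => ?_
      have hU' : U.card = i := by simpa using hU
      rcases lt_or_ge i k with h | h
      · rw [hb.subsetSum_eq_zero_of_lt (by omega)]; simp
      · rw [hb.subsetSum_eq_zero_of_gt (by omega)]; simp
    rw [h0]
    split_ifs with hkk
    · rcases lt_or_ge i k with h | h
      · rw [intBinom_eq_zero_of_neg _ (by omega)]; simp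
      · rw [intBinom_eq_zero_of_lt (by omega)]; simp
    · rfl
  obtain ⟨hi1, hi2⟩ := hi
  -- Expanding the first factor, the sum over `U` becomes the action of the matrix of the inclusion
  -- relation between `k`-sets and `i`-sets on `subsetSum b'`.
  have h1 : ∑ U with U.card = i, star (subsetSum b U) * subsetSum b' U =
      ∑ K, star (b K) * ∑ V with V.card = i,
        (if (V ∩ K).card = k then 1 else 0) * subsetSum b' V := by
    have : ∀ U, star (subsetSum b U) = ∑ K ∈ U.powerset, star (b K) := fun U => star_sum _ _
    simp only [this, Finset.mul_sum, Finset.sum_mul]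
    rw [Finset.sum_comm' (t' := Finset.univ)
      (s' := fun K => Finset.univ.filter fun V => V.card = i ∧ K ⊆ V)
      (by intro V K; simp)]
    refine Finset.sum_congr rfl fun K _ => ?_
    by_cases hK : b K = 0
    · simp [hK]
    rw [← Finset.filter_filter, Finset.sum_filter]
    refine Finset.sum_congr rfl fun V _ => ?_
    have : K ⊆ V ↔ (V ∩ K).card = k := by
      rw [← hb.card_eq K hK]
      constructor
      · intro h; rw [Finset.inter_eq_right.2 h]
      · intro h; exact Finset.inter_eq_right.1
          (Finset.eq_of_subset_of_card_le Finset.inter_subset_right h.ge)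
    simp [this]
  rw [h1]
  have h2 : ∀ K, star (b K) * ∑ V with V.card = i,
        (if (V ∩ K).card = k then 1 else 0) * subsetSum b' V =
      ((∑ s ∈ Finset.range (k' + 1), (-1 : ℝ) ^ (k' - s) * k'.choose s *
          (intBinom ((k : ℤ) - s) ((k : ℤ) - s) *
            intBinom ((Fintype.card α : ℤ) + s - k - k')
              ((Fintype.card α : ℤ) + k - k - i)) : ℝ) : ℂ) *
        (star (b K) * subsetSum b' K) := by
    intro K
    by_cases hK : b K = 0
    · simp [hK]
    have hc := hb.card_eq K hK
    rw [hb'.sum_weight_mul_subsetSum K i (fun t => if t = k then 1 else 0),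
      Finset.sum_eq_single_of_mem k (by simp; omega) (by intro t _ ht; simp [ht]), hc]
    simp only [if_true]
    ring
  rw [Finset.sum_congr rfl fun K _ => h2 K, ← Finset.mul_sum]
  split_ifs with hkk
  · subst hkk
    rw [sum_alternating_intBinom hi1 hi2]
    congr 1
    refine Finset.sum_congr rfl fun K _ => ?_
    by_cases hK : b K = 0
    · simp [hK]
    · rw [hb'.subsetSum_of_card_eq (hb.card_eq K hK)]
  · rw [hb.sum_star_mul_subsetSum_eq_zero hb' hkk, mul_zero]

/-- The sesquilinear form of an intersection matrix on vectors coming from null functions: it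
vanishes for different degrees and is given by the numbers `β` for equal degrees. -/
theorem IsNull.sum_sum_star_subsetSum_mul {k k' : ℕ} {b b' : Finset α → ℂ}
    (hb : IsNull k b) (hb' : IsNull k' b') (i j : ℕ) (y : ℕ → ℂ) :
    ∑ U with U.card = i, ∑ V with V.card = j,
        star (subsetSum b U) * y (U ∩ V).card * subsetSum b' V =
      if k = k' then
        (∑ t ∈ Finset.range (Fintype.card α + 1),
          (betaCoeff (Fintype.card α) t i j k : ℂ) * y t) * ∑ K, star (b K) * b' K
      else 0 := by
  have h1 : ∀ U ∈ Finset.univ.filter (fun U : Finset α => U.card = i),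
      ∑ V with V.card = j, star (subsetSum b U) * y (U ∩ V).card * subsetSum b' V =
      (∑ t ∈ Finset.range (Fintype.card α + 1), y t *
        ((∑ s ∈ Finset.range (k' + 1), (-1 : ℝ) ^ (k' - s) * k'.choose s *
          (intBinom ((i : ℤ) - s) ((t : ℤ) - s) *
            intBinom ((Fintype.card α : ℤ) + s - i - k')
              ((Fintype.card α : ℤ) + t - i - j)) : ℝ) : ℂ)) *
        (star (subsetSum b U) * subsetSum b' U) := by
    intro U hU
    have hU' : U.card = i := by simpa using hU
    have := hb'.sum_weight_mul_subsetSum U j y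
    rw [hU'] at this
    rw [mul_left_comm, ← this, Finset.mul_sum]
    refine Finset.sum_congr rfl fun V _ => ?_
    rw [Finset.inter_comm]; ring
  rw [Finset.sum_congr rfl h1, ← Finset.mul_sum, hb.sum_star_subsetSum_mul_subsetSum hb']
  split_ifs with hk
  · subst hk
    rw [← mul_assoc, Finset.sum_mul]
    congr 1
    refine Finset.sum_congr rfl fun t _ => ?_
    rw [betaCoeff_natCast]
    push_cast
    ring
  · simp

end Subsets

/-! ### Ranges and positive semidefiniteness of complex matrices -/

/-- Orthogonal decomposition along the range of a matrix. -/
theorem Matrix.exists_eq_mulVec_add {m n : Type*} [Fintype m] [Fintype n] [DecidableEq m]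
    [DecidableEq n] (A : Matrix m n ℂ) (f : m → ℂ) :
    ∃ (g : n → ℂ) (b : m → ℂ), f = A.mulVec g + b ∧ A.conjTranspose.mulVec b = 0 := by
  obtain ⟨r, ⟨g, rfl⟩, z, hz, h⟩ :=
    (LinearMap.range (Matrix.toEuclideanLin A)).exists_add_mem_mem_orthogonal (WithLp.toLp 2 f)
  refine ⟨g.ofLp, z.ofLp, ?_, ?_⟩
  · simpa using congrArg WithLp.ofLp h
  · have h0 : Matrix.toEuclideanLin A.conjTranspose z = 0 := by
      rw [Matrix.toEuclideanLin_conjTranspose_eq_adjoint]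
      refine ext_inner_left ℂ fun v => ?_
      rw [LinearMap.adjoint_inner_right, inner_zero_right]
      exact (Submodule.mem_orthogonal _ _).1 hz _ ⟨v, rfl⟩
    simpa using congrArg WithLp.ofLp h0

/-- Over the complex numbers a matrix with nonnegative quadratic form is automatically Hermitian. -/
theorem Matrix.PosSemidef.of_dotProduct_mulVec_nonneg_complex {m : Type*} [Fintype m]
    [DecidableEq m] {A : Matrix m m ℂ} (h : ∀ f : m → ℂ, 0 ≤ star f ⬝ᵥ A.mulVec f) :
    A.PosSemidef := by
  refine .of_dotProduct_mulVec_nonneg ?_ h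
  rw [← Matrix.isSymmetric_toEuclideanLin_iff, LinearMap.isSymmetric_iff_inner_map_self_real]
  intro v
  rw [Complex.conj_eq_iff_im, ← inner_conj_symm]
  have := (Complex.nonneg_iff.1 (h v.ofLp)).2
  rw [dotProduct_comm] at this
  rw [Complex.conj_im]
  rw [EuclideanSpace.inner_eq_star_dotProduct]
  simpa using this.symm

/-- A matrix that is block diagonal with respect to the fibres of a map is positive semidefinite if
its diagonal blocks are. -/
theorem Matrix.PosSemidef.of_fibers {m o : Type*} [Fintype m] [DecidableEq m] [DecidableEq o]
    {A : Matrix m m ℂ} (κ : m → o) (h0 : ∀ u v, κ u ≠ κ v → A u v = 0)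
    (h : ∀ w, (A.submatrix (Subtype.val : {u // κ u = w} → m) Subtype.val).PosSemidef) :
    A.PosSemidef := by
  refine .of_dotProduct_mulVec_nonneg_complex fun f => ?_
  have key : star f ⬝ᵥ A.mulVec f = ∑ w ∈ Finset.univ.image κ,
      ∑ u : {u // κ u = w}, ∑ v : {v // κ v = w}, star (f u) * A u v * f v := by
    simp only [dotProduct, Matrix.mulVec, Finset.mul_sum, Pi.star_apply, ← mul_assoc]
    rw [← Finset.sum_fiberwise_of_maps_to (g := κ) (t := Finset.univ.image κ)
      (fun u _ => Finset.mem_image_of_mem κ (Finset.mem_univ u))]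
    refine Finset.sum_congr rfl fun w _ => ?_
    rw [Finset.sum_subtype (p := fun u => κ u = w) _ (by simp)]
    refine Finset.sum_congr rfl fun u _ => ?_
    rw [← Finset.sum_subtype (p := fun u => κ u = w) (Finset.univ.filter fun u => κ u = w)
      (by simp) (fun v => star (f u) * A u v * f v)]
    symm
    refine Finset.sum_subset (Finset.subset_univ _) fun v _ hv => ?_
    rw [h0 u v (by rw [u.2]; simpa [eq_comm] using hv)]
    simp
  rw [key]
  refine Finset.sum_nonneg fun w _ => ?_
  refine ((h w).dotProduct_mulVec_nonneg fun u => f u).trans_eq ?_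
  simp only [dotProduct, Matrix.mulVec, Finset.mul_sum, Pi.star_apply, ← mul_assoc,
    Matrix.submatrix_apply]

/-! ### Decomposition into null functions -/

section Subsets

variable {α : Type*} [Fintype α] [DecidableEq α]

/-- Every function on subsets is the sum of a raised function and of one killed by the lowering
operator, the latter being the adjoint of the raising operator. -/
theorem exists_eq_sum_erase_add (f : Finset α → ℂ) :
    ∃ g b : Finset α → ℂ, (∀ U, f U = ∑ x ∈ U, g (U.erase x) + b U) ∧
      ∀ J, ∑ x ∈ Jᶜ, b (insert x J) = 0 := by
  obtain ⟨g, b, h, hb⟩ := Matrix.exists_eq_mulVec_add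
    (Matrix.of fun U J : Finset α => ∑ x ∈ U, if U.erase x = J then (1 : ℂ) else 0) f
  refine ⟨g, b, fun U => ?_, fun J => ?_⟩
  · have := congrFun h U
    simp only [Pi.add_apply, Matrix.mulVec, dotProduct, Matrix.of_apply, Finset.sum_mul] at this
    rw [this, Finset.sum_comm]
    simp
  · have := congrFun hb J
    simp only [Matrix.mulVec, dotProduct, Matrix.conjTranspose_apply, Matrix.of_apply, star_sum,
      Finset.sum_mul, Pi.zero_apply] at this
    have h2 := sum_insert_compl_eq (fun J' K : Finset α => if J' = J then b K else 0)
    rw [Finset.sum_eq_single_of_mem J (Finset.mem_univ J)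
      (by intro J' _ hne; simp [hne])] at h2
    simp only [if_true] at h2
    refine h2.trans (Eq.trans ?_ this)
    refine Finset.sum_congr rfl fun U _ => Finset.sum_congr rfl fun x _ => ?_
    split_ifs <;> simp

/-- Raising `subsetSum b` multiplies it by a scalar on each level. -/
theorem IsNull.sum_subsetSum_erase {k : ℕ} {b : Finset α → ℂ} (hb : IsNull k b) (U : Finset α) :
    ∑ x ∈ U, subsetSum b (U.erase x) = ((U.card : ℂ) - k) * subsetSum b U := by
  simp only [subsetSum, Finset.mul_sum]
  rw [Finset.sum_comm' (t' := U.powerset) (s' := fun K => U \ K)]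
  · refine Finset.sum_congr rfl fun K hK => ?_
    by_cases h : b K = 0
    · simp [h]
    have hKU := Finset.mem_powerset.1 hK
    rw [Finset.sum_const, Finset.card_sdiff_of_subset hKU, hb.card_eq K h, nsmul_eq_mul,
      Nat.cast_sub (by rw [← hb.card_eq K h]; exact Finset.card_le_card hKU)]
  · intro x K
    simp only [Finset.mem_powerset, Finset.mem_sdiff, Finset.subset_erase]
    tauto

theorem IsNull.smul {k : ℕ} {b : Finset α → ℂ} (hb : IsNull k b) (c : ℂ) :
    IsNull k (fun K => c * b K) where
  card_eq K hK := hb.card_eq K (right_ne_zero_of_mul hK)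
  sum_insert J := by rw [← Finset.mul_sum, hb.sum_insert, mul_zero]

theorem isNull_zero (k : ℕ) : IsNull k (0 : Finset α → ℂ) where
  card_eq K hK := absurd rfl hK
  sum_insert J := by simp

theorem isNull_restrict {b : Finset α → ℂ} (hb : ∀ J, ∑ x ∈ Jᶜ, b (insert x J) = 0) (k : ℕ) :
    IsNull k (fun K => if K.card = k then b K else 0) where
  card_eq K hK := by by_contra h; simp [h] at hK
  sum_insert J := by
    have : ∀ x ∈ Jᶜ, (if (insert x J).card = k then b (insert x J) else 0) =
        if J.card + 1 = k then b (insert x J) else 0 := by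
      intro x hx
      rw [Finset.card_insert_of_notMem (by simpa using hx)]
    rw [Finset.sum_congr rfl this]
    split_ifs
    · exact hb J
    · simp

/-- By induction on the level: the part of `f` in the range of the raising operator comes from level
`i`, and the rest is null of degree `i + 1`. -/
theorem exists_isNull_decomposition (i : ℕ) (f : Finset α → ℂ) :
    ∃ b : ℕ → Finset α → ℂ, (∀ k, IsNull k (b k)) ∧
      ∀ U : Finset α, U.card = i → f U = ∑ k ∈ Finset.range (i + 1), subsetSum (b k) U := by
  induction i generalizing f with
  | zero =>
    obtain ⟨g, b, h, hb⟩ := exists_eq_sum_erase_add f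
    refine ⟨fun k K => if K.card = k then b K else 0, isNull_restrict hb, fun U hU => ?_⟩
    obtain rfl := Finset.card_eq_zero.1 hU
    simp [h, subsetSum]
  | succ i ih =>
    obtain ⟨g, b, h, hb⟩ := exists_eq_sum_erase_add f
    obtain ⟨c, hc, hg⟩ := ih g
    refine ⟨fun k => if k = i + 1 then fun K => if K.card = i + 1 then b K else 0 else
      fun K => ((i : ℂ) + 1 - k) * c k K, fun k => ?_, fun U hU => ?_⟩
    · dsimp only
      split_ifs with hk
      · subst hk; exact isNull_restrict hb _
      · exact (hc k).smul _
    · rw [Finset.sum_range_succ, h]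
      congr 1
      · rw [Finset.sum_congr rfl fun x hx => hg (U.erase x)
          (by rw [Finset.card_erase_of_mem hx, hU]; rfl), Finset.sum_comm]
        refine Finset.sum_congr rfl fun k hk => ?_
        dsimp only
        rw [(hc k).sum_subsetSum_erase, hU, if_neg (by simp at hk; omega)]
        simp [subsetSum, Finset.mul_sum]
      · dsimp only
        rw [if_pos rfl, (isNull_restrict hb _).subsetSum_of_card_eq hU, if_pos hU]

/-- The null functions that contribute to level `i` may be taken to vanish unless `k ≤ i ≤ m - k`;
in particular only degrees `k ≤ m / 2` occur. -/
theorem exists_isNull_decomposition_of_range (i : ℕ) (f : Finset α → ℂ) :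
    ∃ b : ℕ → Finset α → ℂ, (∀ k, IsNull k (b k)) ∧
      (∀ k, ¬ (k ≤ i ∧ i + k ≤ Fintype.card α) → b k = 0) ∧
      ∀ U : Finset α, U.card = i →
        f U = ∑ k ∈ Finset.range (Fintype.card α / 2 + 1), subsetSum (b k) U := by
  obtain ⟨b, hb, hf⟩ := exists_isNull_decomposition i f
  refine ⟨fun k => if k ≤ i ∧ i + k ≤ Fintype.card α then b k else 0, fun k => ?_,
    fun k hk => if_neg hk, fun U hU => ?_⟩
  · dsimp only
    split_ifs
    · exact hb k
    · exact isNull_zero k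
  · have h0 : ∀ k, subsetSum (if k ≤ i ∧ i + k ≤ Fintype.card α then b k else 0) U =
        subsetSum (b k) U := by
      intro k
      split_ifs with hk
      · rfl
      · rcases lt_or_ge i k with h | h
        · rw [(hb k).subsetSum_eq_zero_of_lt (by omega)]; simp [subsetSum]
        · rw [(hb k).subsetSum_eq_zero_of_gt (by omega)]; simp [subsetSum]
    simp only [h0]
    rw [hf U hU]
    have hi : i ≤ Fintype.card α := hU ▸ Finset.card_le_univ U
    refine (Finset.sum_subset (s₂ := Finset.range (Fintype.card α + 1))
      (by intro x; simp; omega) ?_).trans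
      (Finset.sum_subset (by intro x; simp; omega) ?_).symm
    · intro k _ hk
      exact (hb k).subsetSum_eq_zero_of_lt (by simp at hk; omega)
    · intro k _ hk
      simp at hk
      rcases lt_or_ge i k with h | h
      · exact (hb k).subsetSum_eq_zero_of_lt (by omega)
      · exact (hb k).subsetSum_eq_zero_of_gt (by omega)

/-- For `2k ≤ m` there are more `k`-sets than `(k - 1)`-sets, so the lowering operator has a
nontrivial kernel on functions on `k`-sets. -/
theorem exists_isNull_ne_zero {k : ℕ} (hk : 2 * k ≤ Fintype.card α) :
    ∃ b : Finset α → ℂ, IsNull k b ∧ b ≠ 0 := by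
  let ext : ({K : Finset α // K.card = k} → ℂ) →ₗ[ℂ] (Finset α → ℂ) :=
    { toFun := fun v K => if h : K.card = k then v ⟨K, h⟩ else 0
      map_add' := by intro v w; ext K; by_cases h : K.card = k <;> simp [h]
      map_smul' := by intro c v; ext K; by_cases h : K.card = k <;> simp [h] }
  let T : ({K : Finset α // K.card = k} → ℂ) →ₗ[ℂ] ({J : Finset α // J.card + 1 = k} → ℂ) :=
    { toFun := fun v J => ∑ x ∈ (J : Finset α)ᶜ, ext v (insert x J)
      map_add' := by intro v w; ext J; simp [Finset.sum_add_distrib]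
      map_smul' := by intro c v; ext J; simp [Finset.mul_sum] }
  have hlt : Module.finrank ℂ ({J : Finset α // J.card + 1 = k} → ℂ) <
      Module.finrank ℂ ({K : Finset α // K.card = k} → ℂ) := by
    rw [Module.finrank_fintype_fun_eq_card, Module.finrank_fintype_fun_eq_card,
      Fintype.card_finset_len]
    cases k with
    | zero => simp
    | succ k =>
      simp only [Nat.add_right_cancel_iff]
      rw [Fintype.card_finset_len]
      have h := Nat.choose_succ_right_eq (Fintype.card α) k
      have h1 : 0 < (Fintype.card α).choose k := Nat.choose_pos (by omega)
      by_contra hcon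
      push Not at hcon
      have h2 : k + 2 ≤ Fintype.card α - k := by omega
      nlinarith
  obtain ⟨v, hv, hne⟩ := (Submodule.ne_bot_iff _).1 (T.ker_ne_bot_of_finrank_lt hlt)
  refine ⟨ext v, ⟨fun K hK => ?_, fun J => ?_⟩, fun h0 => hne ?_⟩
  · by_contra h
    exact hK (dif_neg h)
  · by_cases hJ : J.card + 1 = k
    · exact congrFun (LinearMap.mem_ker.1 hv) ⟨J, hJ⟩
    · refine Finset.sum_eq_zero fun x hx => dif_neg ?_
      rwa [Finset.card_insert_of_notMem (by simpa using hx)]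
  · ext ⟨K, hK⟩
    have := congrFun h0 K
    simpa [ext, hK] using this

end Subsets

/-! ### Intersection matrices on subsets -/

section Subsets

variable {α : Type*} [Fintype α] [DecidableEq α]

/-- The matrix, indexed by the subsets of `α`, whose `(U, V)` entry is `y |U| |V| |U ∩ V|`: a
general element of the Terwilliger algebra of the binary Hamming cube. -/
noncomputable def subsetMatrix (α : Type*) [Fintype α] [DecidableEq α] (y : ℕ → ℕ → ℕ → ℂ) :
    Matrix (Finset α) (Finset α) ℂ :=
  fun U V => y U.card V.card (U ∩ V).card

/-- The number `∑_t β_{i,j,k}^{m,t} y_{i,j}^t`. -/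
noncomputable def betaSum (m : ℕ) (y : ℕ → ℕ → ℕ → ℂ) (k i j : ℕ) : ℂ :=
  ∑ t ∈ Finset.range (m + 1), (betaCoeff m t i j k : ℂ) * y i j t

/-- The block `(∑_t β_{i,j,k}^{m,t} y_{i,j}^t)` with `k ≤ i, j ≤ m - k`. -/
noncomputable def betaBlock (m : ℕ) (y : ℕ → ℕ → ℕ → ℂ) (k : ℕ) :
    Matrix (Finset.Icc k (m - k)) (Finset.Icc k (m - k)) ℂ :=
  fun i j => betaSum m y k i j

/-- The block is, up to a positive scalar, a compression of the intersection matrix to the span of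
the vectors obtained from one nonzero null function of degree `k`. -/
theorem posSemidef_betaBlock {y : ℕ → ℕ → ℕ → ℂ} (h : (subsetMatrix α y).PosSemidef)
    {k : ℕ} (hk : 2 * k ≤ Fintype.card α) : (betaBlock (Fintype.card α) y k).PosSemidef := by
  obtain ⟨b, hb, hne⟩ := exists_isNull_ne_zero hk
  have hpos : 0 < ∑ K, star (b K) * b K := by
    obtain ⟨K, hK⟩ := Function.ne_iff.1 hne
    exact Finset.sum_pos' (fun L _ => star_mul_self_nonneg _)
      ⟨K, Finset.mem_univ K, star_mul_self_pos (isUnit_iff_ne_zero.2 hK).isRegular⟩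
  let W : Matrix (Finset α) (Finset.Icc k (Fintype.card α - k)) ℂ :=
    fun U i => if U.card = i then subsetSum b U else 0
  have hW : W.conjTranspose * subsetMatrix α y * W =
      (∑ K, star (b K) * b K) • betaBlock (Fintype.card α) y k := by
    ext i j
    have := hb.sum_sum_star_subsetSum_mul hb i j (y i j)
    rw [if_pos rfl] at this
    rw [Matrix.smul_apply, smul_eq_mul, mul_comm]
    refine Eq.trans ?_ this
    simp only [Matrix.mul_apply, Finset.sum_mul, Finset.sum_filter, Matrix.conjTranspose_apply]
    rw [Finset.sum_comm]
    refine Finset.sum_congr rfl fun U _ => ?_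
    split_ifs with hU
    · refine Finset.sum_congr rfl fun V _ => ?_
      split_ifs with hV
      · simp [W, hU, hV, subsetMatrix]
      · simp [W, hV]
    · simp [W, hU]
  have h2 := (h.conjTranspose_mul_mul_same W).smul (inv_nonneg.2 hpos.le)
  rwa [hW, smul_smul, inv_mul_cancel₀ hpos.ne', one_smul] at h2

/-- The quadratic form of a block, written as a sum over all levels. -/
theorem sum_sum_star_mul_betaSum_mul_nonneg {m : ℕ} {y : ℕ → ℕ → ℕ → ℂ} {k : ℕ}
    (h : (betaBlock m y k).PosSemidef) {v : ℕ → ℂ}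
    (hv : ∀ i, ¬ (k ≤ i ∧ i + k ≤ m) → v i = 0) :
    0 ≤ ∑ i ∈ Finset.range (m + 1), ∑ j ∈ Finset.range (m + 1),
      star (v i) * betaSum m y k i j * v j := by
  have hsum : ∀ F : ℕ → ℂ, (∀ i, v i = 0 → F i = 0) →
      ∑ i ∈ Finset.range (m + 1), F i = ∑ i : Finset.Icc k (m - k), F i := by
    intro F hF
    rw [Finset.sum_coe_sort (Finset.Icc k (m - k)) F]
    symm
    refine Finset.sum_subset (by intro x; simp; omega) fun i _ hi => hF i (hv i ?_)
    simp at hi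
    omega
  have := h.dotProduct_mulVec_nonneg fun i => v i
  rw [hsum _ (by intro i hi; simp [hi])]
  simp only [fun i => hsum (fun j => star (v i) * betaSum m y k i j * v j)
    (by intro j hj; simp [hj])]
  refine this.trans_eq ?_
  simp only [dotProduct, Matrix.mulVec, Finset.mul_sum, betaBlock, Pi.star_apply, mul_assoc]

/-- Decomposing a vector level by level into null functions `b i k`, its quadratic form becomes a
sum over `k` and over sets `K` of the quadratic forms of the blocks at the vectors `i ↦ b i k K`. -/
theorem posSemidef_subsetMatrix {y : ℕ → ℕ → ℕ → ℂ}
    (h : ∀ k, 2 * k ≤ Fintype.card α → (betaBlock (Fintype.card α) y k).PosSemidef) :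
    (subsetMatrix α y).PosSemidef := by
  refine .of_dotProduct_mulVec_nonneg_complex fun f => ?_
  set m := Fintype.card α with hm
  choose b hb hb0 hf using fun i => exists_isNull_decomposition_of_range (α := α) i f
  have hmaps : ∀ U ∈ (Finset.univ : Finset (Finset α)), U.card ∈ Finset.range (m + 1) :=
    fun U _ => by simpa [Nat.lt_succ_iff] using Finset.card_le_univ U
  have key : star f ⬝ᵥ (subsetMatrix α y).mulVec f =
      ∑ k ∈ Finset.range (m / 2 + 1), ∑ K, ∑ i ∈ Finset.range (m + 1),
        ∑ j ∈ Finset.range (m + 1), star (b i k K) * betaSum m y k i j * b j k K := by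
    calc star f ⬝ᵥ (subsetMatrix α y).mulVec f
        = ∑ U, ∑ V, star (f U) * y U.card V.card (U ∩ V).card * f V := by
          simp only [dotProduct, Matrix.mulVec, Finset.mul_sum, subsetMatrix, Pi.star_apply,
            mul_assoc]
      _ = ∑ i ∈ Finset.range (m + 1), ∑ j ∈ Finset.range (m + 1),
            ∑ U with U.card = i, ∑ V with V.card = j,
              star (f U) * y U.card V.card (U ∩ V).card * f V := by
          have hfib : ∀ F : Finset α → ℂ,
              ∑ U, F U = ∑ i ∈ Finset.range (m + 1), ∑ U with U.card = i, F U :=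
            fun F => (Finset.sum_fiberwise_of_maps_to hmaps F).symm
          refine (hfib _).trans (Finset.sum_congr rfl fun i _ => ?_)
          rw [Finset.sum_comm]
          exact (hfib _).trans (Finset.sum_congr rfl fun j _ => Finset.sum_comm)
      _ = ∑ i ∈ Finset.range (m + 1), ∑ j ∈ Finset.range (m + 1),
            ∑ k ∈ Finset.range (m / 2 + 1), ∑ k' ∈ Finset.range (m / 2 + 1),
              ∑ U with U.card = i, ∑ V with V.card = j,
                star (subsetSum (b i k) U) * y i j (U ∩ V).card * subsetSum (b j k') V := by
          refine Finset.sum_congr rfl fun i _ => Finset.sum_congr rfl fun j _ => ?_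
          have : ∀ U ∈ (Finset.univ : Finset (Finset α)).filter (fun U => U.card = i),
              ∀ V ∈ (Finset.univ : Finset (Finset α)).filter (fun V => V.card = j),
              star (f U) * y U.card V.card (U ∩ V).card * f V =
              ∑ k ∈ Finset.range (m / 2 + 1), ∑ k' ∈ Finset.range (m / 2 + 1),
                star (subsetSum (b i k) U) * y i j (U ∩ V).card * subsetSum (b j k') V := by
            intro U hU V hV
            have hU' : U.card = i := by simpa using hU
            have hV' : V.card = j := by simpa using hV
            rw [hf i U hU', hf j V hV', hU', hV', star_sum]
            simp only [Finset.sum_mul, Finset.mul_sum]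
            rw [Finset.sum_comm]
          rw [Finset.sum_congr rfl fun U hU => Finset.sum_congr rfl (this U hU)]
          rw [Finset.sum_congr rfl fun U _ => Finset.sum_comm, Finset.sum_comm]
          refine Finset.sum_congr rfl fun k _ => ?_
          rw [Finset.sum_congr rfl fun U _ => Finset.sum_comm, Finset.sum_comm]
      _ = ∑ i ∈ Finset.range (m + 1), ∑ j ∈ Finset.range (m + 1),
            ∑ k ∈ Finset.range (m / 2 + 1),
              betaSum m y k i j * ∑ K, star (b i k K) * b j k K := by
          refine Finset.sum_congr rfl fun i _ => Finset.sum_congr rfl fun j _ =>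
            Finset.sum_congr rfl fun k hk => ?_
          rw [Finset.sum_congr rfl fun k' _ =>
            (hb i k).sum_sum_star_subsetSum_mul (hb j k') i j (y i j), Finset.sum_ite_eq,
            if_pos hk]
          rfl
      _ = _ := by
          simp only [Finset.mul_sum]
          rw [Finset.sum_congr rfl fun i _ => Finset.sum_comm, Finset.sum_comm]
          refine Finset.sum_congr rfl fun k _ => ?_
          rw [Finset.sum_congr rfl fun i _ => Finset.sum_comm, Finset.sum_comm]
          refine Finset.sum_congr rfl fun K _ => Finset.sum_congr rfl fun i _ => ?_
          rw [Finset.sum_congr rfl]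
          intro j _
          ring
  rw [key]
  refine Finset.sum_nonneg fun k hk => Finset.sum_nonneg fun K _ => ?_
  refine sum_sum_star_mul_betaSum_mul_nonneg (v := fun i => b i k K) (h k ?_) fun i hi => ?_
  · simp at hk; omega
  · rw [hb0 i k hi]; rfl

/-- The block diagonalization of the Terwilliger algebra of the binary Hamming cube. -/
theorem posSemidef_subsetMatrix_iff {m : ℕ} (hm : Fintype.card α = m) (y : ℕ → ℕ → ℕ → ℂ) :
    (subsetMatrix α y).PosSemidef ↔ ∀ k, 2 * k ≤ m → (betaBlock m y k).PosSemidef := by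
  subst hm
  exact ⟨fun h _ hk => posSemidef_betaBlock h hk, posSemidef_subsetMatrix⟩

end Subsets

/-! ### A unitary change of basis on letters -/

section Basis

/-- An orthonormal basis of `ℂ^q`, given by the columns of `F`, whose first vector is the basis
vector of the letter `0` and whose second vector is uniform on the nonzero letters. The last two
conditions state the inner products of all the basis vectors with these two directions. -/
theorem exists_adapted_unitary (q : ℕ) (hq : 2 ≤ q) :
    ∃ F : Matrix (Fin q) (Fin q) ℂ, F.conjTranspose * F = 1 ∧
      (∀ c : Fin q, ∑ c', star (F c' c) * (if (c' : ℕ) = 0 then 1 else 0) =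
        if (c : ℕ) = 0 then 1 else 0) ∧
      ∀ c : Fin q, ∑ c', star (F c' c) * (if (c' : ℕ) = 0 then 0 else 1) =
        if (c : ℕ) = 1 then ((√((q : ℝ) - 1) : ℝ) : ℂ) else 0 := by
  have hr : (0 : ℝ) < √((q : ℝ) - 1) := by
    have : (2 : ℝ) ≤ q := by exact_mod_cast hq
    exact Real.sqrt_pos.2 (by linarith)
  have hr2 : ((√((q : ℝ) - 1) : ℝ) : ℂ) * ((√((q : ℝ) - 1) : ℝ) : ℂ) = (q : ℂ) - 1 := by
    rw [← Complex.ofReal_mul, Real.mul_self_sqrt (Real.sqrt_pos.1 hr).le]; simp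
  set r : ℂ := ((√((q : ℝ) - 1) : ℝ) : ℂ) with hrdef
  have hr0 : r ≠ 0 := by rw [hrdef]; exact_mod_cast hr.ne'
  have hrs : star r = r := Complex.conj_ofReal _
  let e : ℕ → ℕ → ℂ := fun c d =>
    if c = 0 then if d = 0 then 1 else 0 else if d = 0 then 0 else r⁻¹
  let v : Fin q → EuclideanSpace ℂ (Fin q) := fun c => WithLp.toLp 2 fun d => e c d
  have hpair : ∀ z w : EuclideanSpace ℂ (Fin q), inner ℂ z w = ∑ c', star (z c') * w c' := by
    intro z w
    rw [EuclideanSpace.inner_eq_star_dotProduct, dotProduct]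
    exact Finset.sum_congr rfl fun _ _ => mul_comm _ _
  obtain ⟨p, rfl⟩ : ∃ p, q = p + 1 := ⟨q - 1, by omega⟩
  have hpc : r * r = p := by rw [hr2]; push_cast; ring
  have hinner : ∀ c d : Fin (p + 1), inner ℂ (v c) (v d) =
      if ((c : ℕ) = 0 ↔ (d : ℕ) = 0) then (1 : ℂ) else 0 := by
    intro c d
    rw [hpair]
    change ∑ c' : Fin (p + 1), star (e c c') * e d c' = _
    rw [Fin.sum_univ_succ]
    generalize (c : ℕ) = c
    generalize (d : ℕ) = d
    have hsucc : (p : ℂ) * (star r⁻¹ * r⁻¹) = 1 := by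
      rw [star_inv₀, hrs, ← hpc]; field_simp
    by_cases hc : c = 0 <;> by_cases hd : d = 0 <;>
      simp only [e, hc, hd, if_true, if_false, Fin.val_zero, Fin.val_succ, Nat.succ_ne_zero,
        Finset.sum_const, Finset.card_univ, Fintype.card_fin, nsmul_eq_mul, hsucc] <;> simp
  have hon : Orthonormal ℂ (Set.domRestrict {c : Fin (p + 1) | (c : ℕ) ≤ 1} v) := by
    rw [orthonormal_iff_ite]
    rintro ⟨c, hc⟩ ⟨d, hd⟩
    have hc' : (c : ℕ) ≤ 1 := hc
    have hd' : (d : ℕ) ≤ 1 := hd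
    refine (hinner c d).trans (if_congr ?_ rfl rfl)
    rw [Subtype.mk.injEq, Fin.ext_iff]
    omega
  obtain ⟨b, hb⟩ := hon.exists_orthonormalBasis_extension_of_card_eq (by simp)
  have hbb := orthonormal_iff_ite.1 b.orthonormal
  refine ⟨Matrix.of fun c' c => b c c', ?_, fun c => ?_, fun c => ?_⟩
  · ext c d
    rw [Matrix.mul_apply, Matrix.one_apply, ← hbb c d, hpair]
    rfl
  · have h1 := hbb c ⟨0, by omega⟩
    rw [hpair, hb ⟨0, by omega⟩ (by simp)] at h1
    refine Eq.trans (Finset.sum_congr rfl fun c' _ => ?_) (h1.trans ?_)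
    · simp only [v, e, Matrix.of_apply, if_true]
    · exact if_congr Fin.ext_iff rfl rfl
  · have h1 := hbb c ⟨1, by omega⟩
    rw [hpair, hb ⟨1, by omega⟩ (by simp)] at h1
    have h2 := congrArg (fun z => r * z) h1
    simp only [Finset.mul_sum] at h2
    refine Eq.trans (Finset.sum_congr rfl fun c' _ => ?_) (h2.trans ?_)
    · simp only [v, e, Matrix.of_apply, one_ne_zero, if_false]
      split_ifs
      · simp
      · field_simp
    · rw [mul_ite, mul_one, mul_zero]
      exact if_congr Fin.ext_iff rfl rfl

end Basis

/-! ### Entries as values of a linear functional on monomials -/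

section Polynomials

open MvPolynomial

/-- The coefficient `x_{i,j}^{t,p}`, replaced by zero outside the index set. -/
def weightedIndicator (q n : ℕ) (x : ℕ → ℕ → ℕ → ℕ → ℂ) (i j t p : ℕ) : ℂ :=
  if (i, j, t, p) ∈ indexSet q n then x i j t p else 0

/-- The linear functional on polynomials in four variables that sends the monomial with exponents
`(i, j, t, p)` to `x_{i,j}^{t,p}` if this belongs to the index set and to zero otherwise. -/
noncomputable def monomialFunctional (q n : ℕ) (x : ℕ → ℕ → ℕ → ℕ → ℂ) :
    MvPolynomial (Fin 4) ℂ →ₗ[ℂ] ℂ :=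
  ∑ s ∈ indexSet q n, x s.1 s.2.1 s.2.2.1 s.2.2.2 •
    MvPolynomial.lcoeff ℂ (Finsupp.single 0 s.1 + Finsupp.single 1 s.2.1 +
      Finsupp.single 2 s.2.2.1 + Finsupp.single 3 s.2.2.2)

theorem monomialFunctional_monomial (q n : ℕ) (x : ℕ → ℕ → ℕ → ℕ → ℂ) (i j t p : ℕ) :
    monomialFunctional q n x (X 0 ^ i * X 1 ^ j * X 2 ^ t * X 3 ^ p) =
      weightedIndicator q n x i j t p := by
  simp only [monomialFunctional, X_pow_eq_monomial, monomial_mul, mul_one, LinearMap.sum_apply,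
    LinearMap.smul_apply, lcoeff_apply, coeff_monomial, weightedIndicator, smul_eq_mul, mul_ite,
    mul_zero]
  have : ∀ s : ℕ × ℕ × ℕ × ℕ, (Finsupp.single (0 : Fin 4) i + Finsupp.single 1 j +
      Finsupp.single 2 t + Finsupp.single 3 p = Finsupp.single 0 s.1 + Finsupp.single 1 s.2.1 +
      Finsupp.single 2 s.2.2.1 + Finsupp.single 3 s.2.2.2) ↔ (i, j, t, p) = s := by
    rintro ⟨i', j', t', p'⟩
    constructor
    · intro h
      have h0 := DFunLike.congr_fun h 0
      have h1 := DFunLike.congr_fun h 1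
      have h2 := DFunLike.congr_fun h 2
      have h3 := DFunLike.congr_fun h 3
      simp at h0 h1 h2 h3
      simp [h0, h1, h2, h3]
    · rintro ⟨rfl, rfl, rfl, rfl⟩; rfl
  simp only [this]
  rw [Finset.sum_ite_eq]

theorem monomialFunctional_C_mul (q n : ℕ) (x : ℕ → ℕ → ℕ → ℕ → ℂ) (c : ℂ)
    (f : MvPolynomial (Fin 4) ℂ) :
    monomialFunctional q n x (C c * f) = c * monomialFunctional q n x f := by
  rw [C_mul', map_smul, smul_eq_mul]

theorem monomialFunctional_mul_aeval (q n : ℕ) (x : ℕ → ℕ → ℕ → ℕ → ℂ) (i j t : ℕ)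
    (f : Polynomial ℂ) :
    monomialFunctional q n x (X 0 ^ i * X 1 ^ j * X 2 ^ t * Polynomial.aeval (X 3) f) =
      ∑ p ∈ Finset.range (n + 1), f.coeff p * weightedIndicator q n x i j t p := by
  induction f using Polynomial.induction_on' with
  | add f g hf hg =>
    simp only [map_add, mul_add, hf, hg, Polynomial.coeff_add, add_mul, Finset.sum_add_distrib]
  | monomial p c =>
    rw [Polynomial.aeval_monomial, mul_left_comm, MvPolynomial.algebraMap_eq,
      monomialFunctional_C_mul, monomialFunctional_monomial]
    simp only [Polynomial.coeff_monomial, ite_mul, zero_mul]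
    rw [Finset.sum_ite_eq]
    split_ifs with hp
    · rfl
    · rw [weightedIndicator, if_neg, mul_zero]
      intro h
      simp only [indexSet, Finset.mem_filter, Finset.mem_product] at h
      exact hp h.1.2.2.2

/-- The monomial that records, for a pair of letters, whether the first is nonzero, whether the
second is nonzero, whether both are, and whether they agree and are nonzero. -/
noncomputable def letterPoly {q : ℕ} (c d : Fin q) : MvPolynomial (Fin 4) ℂ :=
  (if (c : ℕ) ≠ 0 then X 0 else 1) * (if (d : ℕ) ≠ 0 then X 1 else 1) *
    (if (c : ℕ) ≠ 0 ∧ (d : ℕ) ≠ 0 then X 2 else 1) * (if d = c ∧ (c : ℕ) ≠ 0 then X 3 else 1)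

theorem prod_letterPoly {q n : ℕ} (u v : Word q n) :
    ∏ h, letterPoly (u h) (v h) = X 0 ^ (wordSupport u).card * X 1 ^ (wordSupport v).card *
      X 2 ^ (wordSupport u ∩ wordSupport v).card * X 3 ^ (commonNonzero u v).card := by
  simp only [letterPoly, Finset.prod_mul_distrib, Finset.prod_ite, Finset.prod_const,
    wordSupport, commonNonzero, ← Finset.filter_and]
  simp only [one_pow, mul_one]

theorem orbitCombination_apply (q n : ℕ) (x : ℕ → ℕ → ℕ → ℕ → ℂ) (u v : Word q n) :
    orbitCombination q n x u v = monomialFunctional q n x (∏ h, letterPoly (u h) (v h)) := by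
  rw [prod_letterPoly, monomialFunctional_monomial, orbitCombination, Matrix.sum_apply]
  simp only [Matrix.smul_apply, orbitMatrix, smul_eq_mul, mul_ite, mul_one, mul_zero,
    weightedIndicator]
  rw [← Finset.sum_ite_eq (indexSet q n) ((wordSupport u).card, (wordSupport v).card,
    (wordSupport u ∩ wordSupport v).card, (commonNonzero u v).card)
    (fun s => x s.1 s.2.1 s.2.2.1 s.2.2.2)]
  refine Finset.sum_congr rfl fun s _ => if_congr ?_ rfl rfl
  simp [Prod.ext_iff]

/-- The matrix `letterPoly` in the basis of `exists_adapted_unitary`. -/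
noncomputable def adaptedLetterPoly {q : ℕ} (c d : Fin q) : MvPolynomial (Fin 4) ℂ :=
  if 2 ≤ (c : ℕ) ∨ 2 ≤ (d : ℕ) then
    if c = d then X 0 * X 1 * X 2 * (X 3 + C (-1)) else 0
  else
    if (c : ℕ) = 1 then
      if (d : ℕ) = 1 then X 0 * X 1 * X 2 * (X 3 + C ((q : ℂ) - 2))
      else C ((√((q : ℝ) - 1) : ℝ) : ℂ) * X 0
    else
      if (d : ℕ) = 1 then C ((√((q : ℝ) - 1) : ℝ) : ℂ) * X 1 else 1

/-- Expansion of `letterPoly` in products of a function of `c` and a function of `d`, and the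
identity matrix. -/
theorem letterPoly_eq {q : ℕ} (c d : Fin q) :
    letterPoly c d =
      1 * C (if (c : ℕ) = 0 then 1 else 0) * C (if (d : ℕ) = 0 then 1 else 0) +
      X 0 * C (if (c : ℕ) = 0 then 0 else 1) * C (if (d : ℕ) = 0 then 1 else 0) +
      X 1 * C (if (c : ℕ) = 0 then 1 else 0) * C (if (d : ℕ) = 0 then 0 else 1) +
      X 0 * X 1 * X 2 * C (if (c : ℕ) = 0 then 0 else 1) * C (if (d : ℕ) = 0 then 0 else 1) +
      X 0 * X 1 * X 2 * (X 3 - 1) * (C (if c = d then 1 else 0) -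
        C (if (c : ℕ) = 0 then 1 else 0) * C (if (d : ℕ) = 0 then 1 else 0)) := by
  by_cases hc : (c : ℕ) = 0 <;> by_cases hd : (d : ℕ) = 0 <;> by_cases hcd : c = d <;>
    simp_all [letterPoly, Fin.ext_iff, eq_comm]
  ring

/-- The change of basis for a single letter. -/
theorem sum_letterPoly_eq_adaptedLetterPoly {q : ℕ} (hq : 2 ≤ q) {F : Matrix (Fin q) (Fin q) ℂ}
    (hF : F.conjTranspose * F = 1)
    (h0 : ∀ c : Fin q, ∑ c', star (F c' c) * (if (c' : ℕ) = 0 then 1 else 0) =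
        if (c : ℕ) = 0 then 1 else 0)
    (h1 : ∀ c : Fin q, ∑ c', star (F c' c) * (if (c' : ℕ) = 0 then 0 else 1) =
        if (c : ℕ) = 1 then ((√((q : ℝ) - 1) : ℝ) : ℂ) else 0) (c d : Fin q) :
    ∑ c', ∑ d', C (star (F c' c) * F d' d) * letterPoly c' d' = adaptedLetterPoly c d := by
  have hr2 : ((√((q : ℝ) - 1) : ℝ) : ℂ) * ((√((q : ℝ) - 1) : ℝ) : ℂ) = (q : ℂ) - 1 := by
    have : (2 : ℝ) ≤ q := by exact_mod_cast hq
    rw [← Complex.ofReal_mul, Real.mul_self_sqrt (by linarith)]; simp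
  have h0' : ∑ d', F d' d * (if (d' : ℕ) = 0 then 1 else 0) =
      if (d : ℕ) = 0 then (1 : ℂ) else 0 := by
    have := congrArg star (h0 d)
    simpa [star_sum, apply_ite] using this
  have h1' : ∑ d', F d' d * (if (d' : ℕ) = 0 then 0 else 1) =
      if (d : ℕ) = 1 then ((√((q : ℝ) - 1) : ℝ) : ℂ) else 0 := by
    have := congrArg star (h1 d)
    simpa [star_sum, apply_ite] using this
  have hfac : ∀ (k : MvPolynomial (Fin 4) ℂ) (f g : Fin q → ℂ),
      ∑ c', ∑ d', C (star (F c' c) * F d' d) * (k * C (f c') * C (g d')) =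
      k * C (∑ c', star (F c' c) * f c') * C (∑ d', F d' d * g d') := by
    intro k f g
    simp only [map_sum, map_mul, Finset.mul_sum, Finset.sum_mul]
    rw [Finset.sum_comm]
    refine Finset.sum_congr rfl fun _ _ => Finset.sum_congr rfl fun _ _ => ?_
    ring
  have hdiag : ∀ k : MvPolynomial (Fin 4) ℂ,
      ∑ c', ∑ d', C (star (F c' c) * F d' d) * (k * C (if c' = d' then 1 else 0)) =
      k * C (if c = d then 1 else 0) := by
    intro k
    have : (if c = d then (1 : ℂ) else 0) = ∑ c', star (F c' c) * F c' d := by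
      have := congrFun (congrFun hF c) d
      rw [Matrix.mul_apply, Matrix.one_apply] at this
      exact this.symm
    rw [this, map_sum, Finset.mul_sum]
    refine Finset.sum_congr rfl fun c' _ => ?_
    rw [Finset.sum_eq_single_of_mem c' (Finset.mem_univ _)
      (by intro d' _ hne; simp [hne.symm])]
    simp [mul_comm]
  -- `letterPoly_eq` in a form in which each summand is covered by `hfac` or by `hdiag`.
  have hexp : ∀ c' d' : Fin q, letterPoly c' d' =
      1 * C (if (c' : ℕ) = 0 then 1 else 0) * C (if (d' : ℕ) = 0 then 1 else 0) +
      X 0 * C (if (c' : ℕ) = 0 then 0 else 1) * C (if (d' : ℕ) = 0 then 1 else 0) +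
      X 1 * C (if (c' : ℕ) = 0 then 1 else 0) * C (if (d' : ℕ) = 0 then 0 else 1) +
      X 0 * X 1 * X 2 * C (if (c' : ℕ) = 0 then 0 else 1) * C (if (d' : ℕ) = 0 then 0 else 1) +
      X 0 * X 1 * X 2 * (X 3 - 1) * C (if c' = d' then 1 else 0) +
      (-(X 0 * X 1 * X 2 * (X 3 - 1))) *
        C (if (c' : ℕ) = 0 then 1 else 0) * C (if (d' : ℕ) = 0 then 1 else 0) := by
    intro c' d'
    rw [letterPoly_eq]
    ring
  simp only [hexp, mul_add, Finset.sum_add_distrib]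
  simp only [hfac, hdiag, h0, h1, h0', h1']
  unfold adaptedLetterPoly
  have hC : (C ((√((q : ℝ) - 1) : ℝ) : ℂ) : MvPolynomial (Fin 4) ℂ) *
      C ((√((q : ℝ) - 1) : ℝ) : ℂ) = (q : MvPolynomial (Fin 4) ℂ) - 1 := by
    rw [← C_mul, hr2, C_sub, C_1, map_natCast]
  rcases eq_or_ne c d with hcd | hcd
  · subst hcd
    by_cases e0 : (c : ℕ) = 0
    · simp [e0]
    · by_cases e1 : (c : ℕ) = 1
      · simp [e1]
        have : (C (2 : ℂ) : MvPolynomial (Fin 4) ℂ) = 2 := map_ofNat _ 2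
        rw [this]
        linear_combination (X 0 * X 1 * X 2) * hC
      · simp [e0, e1, show 2 ≤ (c : ℕ) by omega]
        ring
  · have hcd' : (c : ℕ) ≠ d := fun h => hcd (Fin.ext h)
    by_cases c0 : (c : ℕ) = 0 <;> by_cases d0 : (d : ℕ) = 0 <;> by_cases c1 : (c : ℕ) = 1 <;>
      by_cases d1 : (d : ℕ) = 1 <;> first | omega | skip
    all_goals
      simp [c0, d0, c1, d1, hcd, mul_comm]
    all_goals intros; omega

end Polynomials

/-! ### Reduction from words to subsets -/

section Words

open MvPolynomial

/-- The matrix `orbitCombination` in the tensor power of the basis of `exists_adapted_unitary`. -/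
noncomputable def adaptedMatrix (q n : ℕ) (x : ℕ → ℕ → ℕ → ℕ → ℂ) :
    Matrix (Word q n) (Word q n) ℂ :=
  fun u v => monomialFunctional q n x (∏ h, adaptedLetterPoly (u h) (v h))

/-- The tensor power of the change of basis is unitary. Since the entries are values of a linear
functional at products over positions, it acts on each position separately. -/
theorem posSemidef_adaptedMatrix_iff {q : ℕ} (hq : 2 ≤ q) (n : ℕ) (x : ℕ → ℕ → ℕ → ℕ → ℂ) :
    (adaptedMatrix q n x).PosSemidef ↔ (orbitCombination q n x).PosSemidef := by
  obtain ⟨F, hF, h0, h1⟩ := exists_adapted_unitary q hq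
  let G : Matrix (Word q n) (Word q n) ℂ := fun u' u => ∏ h, F (u' h) (u h)
  have hGapp : ∀ u' u, G u' u = ∏ h, F (u' h) (u h) := fun _ _ => rfl
  have hG : G.conjTranspose * G = 1 := by
    ext u v
    have : ∀ c d, ∑ c', star (F c' c) * F c' d = if c = d then 1 else 0 := fun c d => by
      have := congrFun (congrFun hF c) d
      rwa [Matrix.mul_apply, Matrix.one_apply] at this
    rw [Matrix.mul_apply, Matrix.one_apply]
    simp only [Matrix.conjTranspose_apply, hGapp, star_prod, ← Finset.prod_mul_distrib]
    rw [← Fintype.prod_sum (fun h c' => star (F c' (u h)) * F c' (v h))]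
    simp only [this]
    rw [Finset.prod_ite_zero]
    simp [funext_iff]
  have hM : G.conjTranspose * orbitCombination q n x * G = adaptedMatrix q n x := by
    ext u v
    have : ∀ h, adaptedLetterPoly (u h) (v h) = ∑ c', ∑ d',
        C (star (F c' (u h)) * F d' (v h)) * letterPoly c' d' := fun h =>
      (sum_letterPoly_eq_adaptedLetterPoly hq hF h0 h1 _ _).symm
    simp only [adaptedMatrix, this]
    rw [Fintype.prod_sum]
    simp only [Fintype.prod_sum, map_sum, Matrix.mul_apply, Finset.sum_mul]
    rw [Finset.sum_comm]
    refine Finset.sum_congr rfl fun u' _ => Finset.sum_congr rfl fun v' _ => ?_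
    rw [Finset.prod_mul_distrib, ← map_prod, monomialFunctional_C_mul, orbitCombination_apply,
      Finset.prod_mul_distrib]
    simp only [Matrix.conjTranspose_apply, hGapp, star_prod]
    ring
  constructor
  · intro h
    have h2 := h.mul_mul_conjTranspose_same G
    have hG' : G * G.conjTranspose = 1 := mul_eq_one_comm.1 hG
    rwa [← hM, ← mul_assoc, ← mul_assoc, hG', one_mul, mul_assoc, hG', mul_one] at h2
  · intro h
    rw [← hM]
    exact h.conjTranspose_mul_mul_same G

/-- The polynomial `(X - 1)^a (X + q - 2)^t`, whose coefficients are the inner sums in `α`. -/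
noncomputable def blockPolynomial (q a t : ℕ) : Polynomial ℂ :=
  (Polynomial.X + Polynomial.C (-1)) ^ a * (Polynomial.X + Polynomial.C ((q : ℂ) - 2)) ^ t

/-- The entry, for `|U| = i`, `|V| = j`, `|U ∩ V| = t`, of the diagonal block of `adaptedMatrix`
with `a` positions of letter at least `2`. The subtractions are meant for `t ≤ i, j`; otherwise the
weighted indicator is zero. -/
noncomputable def blockWeight (q n : ℕ) (x : ℕ → ℕ → ℕ → ℕ → ℂ) (a i j t : ℕ) : ℂ :=
  ((√((q : ℝ) - 1) : ℝ) : ℂ) ^ ((i - t) + (j - t)) *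
    ∑ p ∈ Finset.range (n + 1),
      (blockPolynomial q a t).coeff p * weightedIndicator q n x (i + a) (j + a) (t + a) p

theorem prod_ite_mem_ite_mem {β R : Type*} [Fintype β] [DecidableEq β] [CommMonoid R]
    (U V : Finset β) (b c d : R) :
    ∏ h, (if h ∈ U then if h ∈ V then d else b else if h ∈ V then c else 1) =
      d ^ (U ∩ V).card * b ^ (U.card - (U ∩ V).card) * c ^ (V.card - (U ∩ V).card) := by
  have h1 : ∀ h, (if h ∈ U then if h ∈ V then d else b else if h ∈ V then c else 1) =
      (if h ∈ U ∩ V then d else 1) * (if h ∈ U \ V then b else 1) *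
        (if h ∈ V \ U then c else 1) := by
    intro h
    by_cases hU : h ∈ U <;> by_cases hV : h ∈ V <;> simp [hU, hV]
  have h2 : (U \ V).card = U.card - (U ∩ V).card := by
    rw [Finset.card_sdiff, Finset.inter_comm]
  have h3 : (V \ U).card = V.card - (U ∩ V).card := by
    rw [Finset.card_sdiff]
  simp only [h1, Finset.prod_mul_distrib, Finset.prod_ite_mem, Finset.univ_inter,
    Finset.prod_const, h2, h3]

theorem monomialFunctional_eq_blockWeight (q n : ℕ) (x : ℕ → ℕ → ℕ → ℕ → ℂ) (a : ℕ)
    {i j t : ℕ} (hi : t ≤ i) (hj : t ≤ j) :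
    monomialFunctional q n x ((X 0 * X 1 * X 2 * (X 3 + C (-1))) ^ a *
      ((X 0 * X 1 * X 2 * (X 3 + C ((q : ℂ) - 2))) ^ t *
        (C ((√((q : ℝ) - 1) : ℝ) : ℂ) * X 0) ^ (i - t) *
        (C ((√((q : ℝ) - 1) : ℝ) : ℂ) * X 1) ^ (j - t))) = blockWeight q n x a i j t := by
  generalize hr : ((√((q : ℝ) - 1) : ℝ) : ℂ) = r
  obtain ⟨i, rfl⟩ := Nat.exists_eq_add_of_le hi
  obtain ⟨j, rfl⟩ := Nat.exists_eq_add_of_le hj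
  rw [blockWeight, hr, ← monomialFunctional_mul_aeval, ← monomialFunctional_C_mul]
  congr 1
  simp only [Nat.add_sub_cancel_left, blockPolynomial, map_mul, map_pow, map_add,
    Polynomial.aeval_X, Polynomial.aeval_C, MvPolynomial.algebraMap_eq]
  generalize (X 3 + C (-1) : MvPolynomial (Fin 4) ℂ) = f
  generalize (X 3 + C ((q : ℂ) - 2) : MvPolynomial (Fin 4) ℂ) = g
  ring

/-- Two words with equal letters at least `2` on `A` and letters `0` and `1` elsewhere are described
by the sets of positions of the letter `1`. -/
theorem adaptedMatrix_apply_eq_blockWeight {q n : ℕ} (x : ℕ → ℕ → ℕ → ℕ → ℂ)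
    (A : Fin n → Prop) [DecidablePred A] {u v : Word q n}
    (hA : ∀ h, A h → u h = v h ∧ 2 ≤ (u h : ℕ))
    (hA' : ∀ h, ¬ A h → (u h : ℕ) ≤ 1 ∧ (v h : ℕ) ≤ 1)
    {a : ℕ} (ha : (Finset.univ.filter A).card = a) {U V : Finset {h // ¬ A h}}
    (hU : ∀ h, h ∈ U ↔ (u h : ℕ) = 1) (hV : ∀ h, h ∈ V ↔ (v h : ℕ) = 1) :
    adaptedMatrix q n x u v = subsetMatrix {h // ¬ A h} (blockWeight q n x a) U V := by
  have h1 : ∏ h : {h // A h}, adaptedLetterPoly (u h) (v h) =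
      (X 0 * X 1 * X 2 * (X 3 + C (-1))) ^ a := by
    rw [Finset.prod_congr rfl (g := fun _ => X 0 * X 1 * X 2 * (X 3 + C (-1))), Finset.prod_const,
      Finset.card_univ, Fintype.card_subtype, ha]
    rintro ⟨h, hh⟩ -
    obtain ⟨e1, e2⟩ := hA h hh
    rw [adaptedLetterPoly, if_pos (Or.inl e2), if_pos e1]
  have h2 : ∏ h : {h // ¬ A h}, adaptedLetterPoly (u h) (v h) =
      (X 0 * X 1 * X 2 * (X 3 + C ((q : ℂ) - 2))) ^ (U ∩ V).card *
        (C ((√((q : ℝ) - 1) : ℝ) : ℂ) * X 0) ^ (U.card - (U ∩ V).card) *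
        (C ((√((q : ℝ) - 1) : ℝ) : ℂ) * X 1) ^ (V.card - (U ∩ V).card) := by
    rw [← prod_ite_mem_ite_mem]
    refine Finset.prod_congr rfl fun h _ => ?_
    obtain ⟨e1, e2⟩ := hA' h h.2
    rw [adaptedLetterPoly, if_neg (by omega)]
    simp only [hU, hV]
  rw [adaptedMatrix, ← Fintype.prod_subtype_mul_prod_subtype A, h1, h2, subsetMatrix]
  exact monomialFunctional_eq_blockWeight q n x a (Finset.card_le_card Finset.inter_subset_left)
    (Finset.card_le_card Finset.inter_subset_right)

/-- The adapted matrix is block diagonal with respect to the positions and values of the letters at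
least `2`, and each block is a submatrix of an intersection matrix. -/
theorem posSemidef_adaptedMatrix {q n : ℕ} {x : ℕ → ℕ → ℕ → ℕ → ℂ}
    (h : ∀ a ≤ n, ∀ k, 2 * k ≤ n - a → (betaBlock (n - a) (blockWeight q n x a) k).PosSemidef) :
    (adaptedMatrix q n x).PosSemidef := by
  refine .of_fibers (fun (u : Word q n) h => if 2 ≤ (u h : ℕ) then (u h : ℕ) else 0) ?_ ?_
  · intro u v huv
    obtain ⟨g, hg⟩ := Function.ne_iff.1 huv
    rw [adaptedMatrix, Finset.prod_eq_zero (Finset.mem_univ g), map_zero]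
    have hne : u g ≠ v g := by rintro h; simp [h] at hg
    have : 2 ≤ (u g : ℕ) ∨ 2 ≤ (v g : ℕ) := by
      by_contra hcon
      push Not at hcon
      rw [if_neg (by omega), if_neg (by omega)] at hg
      exact hg rfl
    rw [adaptedLetterPoly, if_pos this, if_neg hne]
  · intro w
    have hcard : Fintype.card {h : Fin n // ¬ 2 ≤ w h} =
        n - (Finset.univ.filter fun h : Fin n => 2 ≤ w h).card := by
      rw [Fintype.card_subtype_compl, Fintype.card_fin, Fintype.card_subtype]
    have hS := (posSemidef_subsetMatrix_iff hcard
      (blockWeight q n x (Finset.univ.filter fun h : Fin n => 2 ≤ w h).card)).2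
        (h _ (by simpa using Finset.card_le_univ (Finset.univ.filter fun h : Fin n => 2 ≤ w h)))
    convert hS.submatrix
      (fun u : {u : Word q n // (fun h => if 2 ≤ (u h : ℕ) then (u h : ℕ) else 0) = w} =>
        Finset.univ.filter fun h : {h : Fin n // ¬ 2 ≤ w h} => (u.1 h : ℕ) = 1) using 1
    ext ⟨u, hu⟩ ⟨v, hv⟩
    have hu' : ∀ h, (if 2 ≤ (u h : ℕ) then (u h : ℕ) else 0) = w h := fun h => congrFun hu h
    have hv' : ∀ h, (if 2 ≤ (v h : ℕ) then (v h : ℕ) else 0) = w h := fun h => congrFun hv h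
    refine adaptedMatrix_apply_eq_blockWeight x (fun h => 2 ≤ w h) ?_ ?_ rfl (by simp) (by simp)
    · intro h hh
      have e1 := hu' h
      have e2 := hv' h
      change u h = v h ∧ 2 ≤ (u h : ℕ)
      rw [Fin.ext_iff]
      split_ifs at e1 e2 <;> omega
    · intro h hh
      have e1 := hu' h
      have e2 := hv' h
      change (u h : ℕ) ≤ 1 ∧ (v h : ℕ) ≤ 1
      split_ifs at e1 e2 <;> omega

theorem card_filter_val_lt {n a : ℕ} (ha : a ≤ n) :
    (Finset.univ.filter fun h : Fin n => (h : ℕ) < a).card = a := by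
  rw [Fin.card_filter_val_lt, min_eq_right ha]

theorem card_subtype_not_val_lt {n a : ℕ} (ha : a ≤ n) :
    Fintype.card {h : Fin n // ¬ (h : ℕ) < a} = n - a := by
  rw [Fintype.card_subtype_compl, Fintype.card_fin, Fintype.card_subtype, card_filter_val_lt ha]

/-- If the letter `2` exists, each intersection matrix is a submatrix of the adapted matrix,
realized by the words with letter `2` in the first `a` positions and `0` or `1` in the others. -/
theorem posSemidef_subsetMatrix_blockWeight {q n : ℕ} {x : ℕ → ℕ → ℕ → ℕ → ℂ} {a : ℕ}
    (hq : a = 0 ∧ 2 ≤ q ∨ 3 ≤ q) (ha : a ≤ n) (h : (adaptedMatrix q n x).PosSemidef) :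
    (subsetMatrix {h : Fin n // ¬ (h : ℕ) < a} (blockWeight q n x a)).PosSemidef := by
  let w : Finset {h : Fin n // ¬ (h : ℕ) < a} → Word q n := fun U g =>
    if hg : (g : ℕ) < a then ⟨2, by omega⟩ else if ⟨g, hg⟩ ∈ U then ⟨1, by omega⟩
      else ⟨0, by omega⟩
  convert h.submatrix w using 1
  ext U V
  have hw : ∀ U (h : {h : Fin n // ¬ (h : ℕ) < a}), h ∈ U ↔ (w U h : ℕ) = 1 := by
    rintro U ⟨g, hg⟩
    simp only [w, dif_neg hg]
    split_ifs with h <;> simp [h]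
  refine (adaptedMatrix_apply_eq_blockWeight x (fun h : Fin n => (h : ℕ) < a)
    (u := w U) (v := w V) ?_ ?_ (card_filter_val_lt ha) (hw U) (hw V)).symm
  · intro h hh
    simp [w, hh]
  · intro h hh
    simp only [w, dif_neg hh]
    constructor <;> split_ifs <;> simp

/-- For `q = 2` the only relevant coefficient of the block polynomial is the leading one, so the
blocks for `a > 0` are determined by the original coefficients. -/
theorem blockWeight_two {n : ℕ} (x : ℕ → ℕ → ℕ → ℕ → ℂ) (a i j t : ℕ) :
    blockWeight 2 n x a i j t = weightedIndicator 2 n x (i + a) (j + a) (t + a) (t + a) := by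
  have hdeg : (blockPolynomial 2 a t).Monic :=
    ((Polynomial.monic_X_add_C _).pow a).mul ((Polynomial.monic_X_add_C _).pow t)
  have hnat : (blockPolynomial 2 a t).natDegree = t + a := by
    rw [blockPolynomial, ((Polynomial.monic_X_add_C _).pow a).natDegree_mul
      ((Polynomial.monic_X_add_C _).pow t), Polynomial.natDegree_pow, Polynomial.natDegree_pow,
      Polynomial.natDegree_X_add_C, Polynomial.natDegree_X_add_C]
    ring
  have hcoeff : (blockPolynomial 2 a t).coeff (t + a) = 1 := by
    rw [← hnat]; exact hdeg.coeff_natDegree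
  rw [blockWeight, show ((2 : ℕ) : ℝ) - 1 = 1 by norm_num, Real.sqrt_one, Complex.ofReal_one,
    one_pow, one_mul]
  by_cases hs : (i + a, j + a, t + a, t + a) ∈ indexSet 2 n
  · rw [Finset.sum_eq_single_of_mem (t + a), hcoeff, one_mul]
    · simp only [indexSet, Finset.mem_filter, Finset.mem_product] at hs
      exact hs.1.2.2.1
    · intro p _ hp
      rw [weightedIndicator, if_neg, mul_zero]
      simp only [indexSet, Finset.mem_filter]
      exact fun h => hp (h.2.2.2.2.2 trivial)
  · rw [weightedIndicator, if_neg hs]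
    refine Finset.sum_eq_zero fun p _ => ?_
    rw [weightedIndicator, if_neg, mul_zero]
    intro h
    have hp : p = t + a := by
      simp only [indexSet, Finset.mem_filter] at h
      exact h.2.2.2.2.2 trivial
    exact hs (hp ▸ h)

theorem posSemidef_betaBlock_blockWeight {q n : ℕ} {x : ℕ → ℕ → ℕ → ℕ → ℂ} (hq : 2 ≤ q)
    (h : (adaptedMatrix q n x).PosSemidef) {a : ℕ} (ha : a ≤ n) {k : ℕ} (hk : 2 * k ≤ n - a) :
    (betaBlock (n - a) (blockWeight q n x a) k).PosSemidef := by
  refine (posSemidef_subsetMatrix_iff (card_subtype_not_val_lt ha) _).1 ?_ k hk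
  rcases hq.lt_or_eq with h3 | rfl
  · exact posSemidef_subsetMatrix_blockWeight (Or.inr h3) ha h
  -- For `q = 2` the matrix for `a` is the principal submatrix of the matrix for `0` on the sets
  -- that contain the first `a` positions.
  · have h0 := posSemidef_subsetMatrix_blockWeight (Or.inl ⟨rfl, le_rfl⟩) (Nat.zero_le n) h
    have h1 : (subsetMatrix (Fin n) (blockWeight 2 n x 0)).PosSemidef := by
      rw [posSemidef_subsetMatrix_iff (card_subtype_not_val_lt (Nat.zero_le n))] at h0
      exact (posSemidef_subsetMatrix_iff (Fintype.card_fin n) _).2 h0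
    convert h1.submatrix (fun U : Finset {h : Fin n // ¬ (h : ℕ) < a} =>
      U.map (Function.Embedding.subtype _) ∪ Finset.univ.filter fun h : Fin n => (h : ℕ) < a)
      using 1
    have hcard : ∀ U : Finset {h : Fin n // ¬ (h : ℕ) < a},
        (U.map (Function.Embedding.subtype _) ∪
          Finset.univ.filter fun h : Fin n => (h : ℕ) < a).card = U.card + a := by
      intro U
      rw [Finset.card_union_of_disjoint, Finset.card_map, card_filter_val_lt ha]
      rw [Finset.disjoint_left]
      intro g hg
      simp only [Finset.mem_map, Function.Embedding.subtype_apply] at hg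
      obtain ⟨g', -, rfl⟩ := hg
      simpa using g'.2
    ext U V
    simp only [Matrix.submatrix_apply, subsetMatrix, ← Finset.inter_union_distrib_right,
      ← Finset.map_inter, hcard, blockWeight_two, Nat.add_zero]

/-- Reduction of the nonbinary case to intersection matrices on subsets. -/
theorem posSemidef_orbitCombination_iff {q : ℕ} (hq : 2 ≤ q) (n : ℕ)
    (x : ℕ → ℕ → ℕ → ℕ → ℂ) :
    (orbitCombination q n x).PosSemidef ↔
      ∀ a ≤ n, ∀ k, 2 * k ≤ n - a → (betaBlock (n - a) (blockWeight q n x a) k).PosSemidef := by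
  rw [← posSemidef_adaptedMatrix_iff hq]
  exact ⟨fun h a ha k hk => posSemidef_betaBlock_blockWeight hq h ha hk, posSemidef_adaptedMatrix⟩

end Words

/-! ### Identification of the blocks -/

section Blocks

theorem coeff_blockPolynomial (q a t p : ℕ) :
    (blockPolynomial q a t).coeff p =
      ((∑ g ∈ Finset.range (p + 1),
        (-1 : ℝ) ^ ((a : ℤ) - g) * intBinom a g * intBinom t ((p : ℤ) - g) *
          ((q : ℝ) - 2) ^ ((t : ℤ) - p + g) : ℝ) : ℂ) := by
  rw [blockPolynomial, Polynomial.coeff_mul, Finset.Nat.sum_antidiagonal_eq_sum_range_succ_mk,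
    Complex.ofReal_sum]
  refine Finset.sum_congr rfl fun g hg => ?_
  have hgp : g ≤ p := by simpa [Nat.lt_succ_iff] using hg
  rw [Polynomial.coeff_X_add_C_pow, Polynomial.coeff_X_add_C_pow, ← Nat.cast_sub hgp,
    intBinom_natCast, intBinom_natCast]
  rcases lt_or_ge a g with h | h
  · simp [Nat.choose_eq_zero_of_lt h]
  rcases lt_or_ge t (p - g) with h' | h'
  · simp [Nat.choose_eq_zero_of_lt h']
  rw [← Nat.cast_sub h, show (t : ℤ) - p + g = ((t - (p - g) : ℕ) : ℤ) by omega, zpow_natCast,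
    zpow_natCast]
  push_cast
  ring

theorem rpow_half_sub {r : ℝ} (hr : 0 < r) {i j t : ℕ} (hi : t ≤ i) (hj : t ≤ j) :
    r ^ (((i : ℝ) + (j : ℝ)) / 2 - (t : ℝ)) = √r ^ ((i - t) + (j - t)) := by
  rw [Real.sqrt_eq_rpow, ← Real.rpow_natCast, ← Real.rpow_mul hr.le]
  congr 1
  push_cast [Nat.cast_sub hi, Nat.cast_sub hj]
  ring

/-- The entries of the blocks in terms of `β` and `blockWeight`. The terms with `t < a` vanish since
`β` does. -/
theorem blockMatrix_apply_eq_betaSum {q n : ℕ} (hq : 2 ≤ q) (x : ℕ → ℕ → ℕ → ℕ → ℂ)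
    {a k i j : ℕ} (hak : a ≤ k) (ha : a ≤ n) (hi : k ≤ i) (hj : k ≤ j) :
    ∑ s ∈ (Finset.range (n + 1) ×ˢ Finset.range (n + 1)).filter
        (fun s => (i, j, s.1, s.2) ∈ indexSet q n),
      (alphaCoeff q n i j s.1 s.2 a k : ℂ) * x i j s.1 s.2 =
    betaSum (n - a) (blockWeight q n x a) (k - a) (i - a) (j - a) := by
  have hr : (0 : ℝ) < (q : ℝ) - 1 := by
    have : (2 : ℝ) ≤ q := by exact_mod_cast hq
    linarith
  rw [Finset.sum_filter, Finset.sum_product]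
  have h1 : ∀ t ∈ Finset.range (n + 1), ∑ p ∈ Finset.range (n + 1),
      (if (i, j, t, p) ∈ indexSet q n then (alphaCoeff q n i j t p a k : ℂ) * x i j t p else 0) =
      if a ≤ t then (betaCoeff ((n - a : ℕ) : ℤ) ((t - a : ℕ) : ℤ) ((i - a : ℕ) : ℤ)
        ((j - a : ℕ) : ℤ) ((k - a : ℕ) : ℤ) : ℂ) *
          blockWeight q n x a (i - a) (j - a) (t - a) else 0 := by
    intro t _
    split_ifs with hat
    · rw [blockWeight, Finset.mul_sum, Finset.mul_sum]
      refine Finset.sum_congr rfl fun p _ => ?_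
      rw [weightedIndicator, Nat.sub_add_cancel hat, Nat.sub_add_cancel (hak.trans hi),
        Nat.sub_add_cancel (hak.trans hj)]
      split_ifs with hmem
      · simp only [indexSet, Finset.mem_filter] at hmem
        rw [alphaCoeff, coeff_blockPolynomial, rpow_half_sub hr hmem.2.2.1 hmem.2.2.2.1,
          Nat.cast_sub ha, Nat.cast_sub hat, Nat.cast_sub (hak.trans hi),
          Nat.cast_sub (hak.trans hj), Nat.cast_sub hak,
          show i - a - (t - a) + (j - a - (t - a)) = i - t + (j - t) by omega]
        push_cast
        ring
      · simp
    · refine Finset.sum_eq_zero fun p _ => ?_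
      have hb : betaCoeff ((n : ℤ) - a) ((t : ℤ) - a) ((i : ℤ) - a) ((j : ℤ) - a)
          ((k : ℤ) - a) = 0 := by
        rw [betaCoeff, Finset.sum_eq_zero, mul_zero]
        intro s hs
        rw [Finset.mem_Icc] at hs
        rw [intBinom_eq_zero_of_neg (b := (t : ℤ) - a - s) _ (by omega)]
        simp
      simp [alphaCoeff, hb]
  rw [Finset.sum_congr rfl h1, ← Finset.sum_filter, betaSum]
  refine Finset.sum_bij' (fun t _ => t - a) (fun t _ => t + a) ?_ ?_ ?_ ?_ ?_
  · intro t ht; simp at ht ⊢; omega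
  · intro t ht; simp at ht ⊢; omega
  · intro t ht; simp at ht ⊢; omega
  · intro t ht; simp
  · intro t ht; rfl

/-- Subtraction of `a`, as a bijection between the index sets of the blocks. -/
def iccShiftEquiv {n a k : ℕ} (hak : a ≤ k) (hk : 2 * k ≤ n + a) :
    Finset.Icc k (n + a - k) ≃ Finset.Icc (k - a) (n - a - (k - a)) where
  toFun i := ⟨i - a, by have := Finset.mem_Icc.1 i.2; rw [Finset.mem_Icc]; omega⟩
  invFun i := ⟨i + a, by have := Finset.mem_Icc.1 i.2; rw [Finset.mem_Icc]; omega⟩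
  left_inv i := by
    have := Finset.mem_Icc.1 i.2
    ext; simp; omega
  right_inv i := by ext; simp

theorem posSemidef_blockMatrix_iff {q n : ℕ} (hq : 2 ≤ q) (x : ℕ → ℕ → ℕ → ℕ → ℂ) {a k : ℕ}
    (hak : a ≤ k) (hk : 2 * k ≤ n + a) :
    (blockMatrix q n x a k).PosSemidef ↔
      (betaBlock (n - a) (blockWeight q n x a) (k - a)).PosSemidef := by
  rw [← Matrix.posSemidef_submatrix_equiv (iccShiftEquiv hak hk)]
  refine iff_of_eq (congrArg _ ?_)
  ext i j
  exact blockMatrix_apply_eq_betaSum hq x hak (by omega) (Finset.mem_Icc.1 i.2).1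
    (Finset.mem_Icc.1 j.2).1

theorem mem_blockPairs {n a k : ℕ} : (a, k) ∈ blockPairs n ↔ a ≤ k ∧ 2 * k ≤ n + a := by
  simp only [blockPairs, Finset.mem_filter, Finset.mem_product, Finset.mem_range]
  omega

end Blocks

theorem mainTheorem1 (q n : ℕ) (hq : 2 ≤ q) (hn : 1 ≤ n) :
    (∀ x : ℕ → ℕ → ℕ → ℕ → ℂ,
      (orbitCombination q n x).PosSemidef ↔
        ∀ s ∈ blockPairs n, (blockMatrix q n x s.1 s.2).PosSemidef) ∧
    Fintype.card (Word q n) = q ^ n ∧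
    (blockPairs n).card ≤ (n + 1) ^ 2 ∧
    (∀ s ∈ blockPairs n, (Finset.Icc s.2 (n + s.1 - s.2)).card ≤ n + 1) := by
  refine ⟨fun x => ?_, by simp, ?_, fun s hs => ?_⟩
  · rw [posSemidef_orbitCombination_iff hq]
    constructor
    · rintro h ⟨a, k⟩ hs
      obtain ⟨h1, h2⟩ := mem_blockPairs.1 hs
      exact (posSemidef_blockMatrix_iff hq x h1 h2).2 (h a (by omega) (k - a) (by omega))
    · intro h a ha k hk
      have := (posSemidef_blockMatrix_iff hq x (a := a) (k := k + a) (by omega) (by omega)).1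
        (h (a, k + a) (mem_blockPairs.2 ⟨by omega, by omega⟩))
      rwa [Nat.add_sub_cancel] at this
  · refine (Finset.card_filter_le _ _).trans ?_
    rw [Finset.card_product, Finset.card_range, sq]
  · obtain ⟨h1, h2⟩ := mem_blockPairs.1 hs
    rw [Nat.card_Icc]
    omega
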